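/- Let $K\subset\mathbb{R}$ be a compact set, and let $G$ be a subgroup of the group $\mathrm{Homeo}(K)$ of homeomorphisms of $K$, generated (as a group) by a finite set $S$. Suppose that every $g\in G$ is locally monotonic, i.e. every point of $K$ has a neighborhood in $K$ on which $g$ is either non-decreasing or non-increasing for the order induced by $\mathbb{R}$. Let $P$ be a probability measure on $S$ with $P(\{s\})>0$ for every $s\in S$, and let $\mathbb{P}=P^{\otimes\mathbb{N}}$ be the product measure on $\Omega=S^{\mathbb{N}}$, $\mathbb N=\{0,1,2,\dots\}$. For $\omega=(\omega_0,\omega_1,\dots)\in\Omega$ and $n\ge 0$ put $f_\omega^n=\omega_{n-1}\circ\cdots\circ\omega_0$ (so $f^0_\omega=\mathrm{id}$). Suppose that there is no Borel probability measure $\mu$ on $K$ with $\mu(g^{-1}(A))=\mu(A)$ for all $g\in G$ and all Borel sets $A\subset K$. Then there exists $\lambda>0$ such that for every $x\in K$, for $\mathbb{P}$-almost every $\omega\in\Omega$, there is a neighborhood $B$ of $x$ in $K$ such that $$\operatorname{diam} f_\omega^n(B)<e^{-n\lambda}\quad\text{for all } n\ge 0 .$$ In particular, $|f_\omega^n(x)-f_\omega^n(y)|\le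 e^{-\lambda n}$ for all $n\ge0$ and all $y\in B$. -/

import Mathlib

open MeasureTheory Topology

/-- A real map on `E ⊆ ℝ` is locally monotonic if every point of `E` has a neighborhood in `E`
on which the map is monotonic, i.e. either non-decreasing or non-increasing. -/
def LocallyMonotonic {E : Set ℝ} (f : E → ℝ) : Prop :=
  ∀ x : E, ∃ U ∈ 𝓝 x, MonotoneOn f U ∨ AntitoneOn f U

/-- The Borel measure `μ` on `K` is invariant for the action of the group `G`. -/
def IsInvariantMeasure {K : Set ℝ} (G : Subgroup (K ≃ₜ K)) (μ : Measure K) : Prop :=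
  ∀ g ∈ G, ∀ A : Set K, MeasurableSet A → μ (g ⁻¹' A) = μ A

/-- The random composition `f_ω^n = f_{ω_{n-1}} ∘ ⋯ ∘ f_{ω_0}` for `ω ∈ S^ℕ`. -/
def randomComp {K : Set ℝ} {S : Set (K ≃ₜ K)} (ω : ℕ → S) : ℕ → K → K
  | 0 => id
  | n + 1 => (ω n : K ≃ₜ K) ∘ randomComp ω n

/-!
Let `m` be a finite measure on `K`. A locally monotonic homeomorphism maps short intervals of `K`
onto intervals, so along a trajectory the `m`-measure of a short interval is multiplied at each step
by a ratio that is close to the Jacobian of the current generator with respect to `m`. If `m`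
dominates lengths, exponential decay of these products gives exponential contraction of diameters.

Negativity of the mean logarithmic Jacobian comes from an entropy argument. Let `μ` be a stationary
probability measure of the random walk that is not invariant. The measure `m` is chosen to dominate
both `μ` and lengths, and such that every generator has a bounded Jacobian `R s` with respect to `m`
(`exists_measure_uIcc_ge_dist`, `exists_measure_ge_map_le_smul`). Writing `μ = k • m`, the Jacobian
of `s` with respect to `μ` is `R s * (k ∘ s) / k`, and the coboundary `log k - log k ∘ s` has mean
zero by stationarity. Concavity of the logarithm then bounds the mean of `log (R s + θ)`, up to an
error that vanishes with `θ`, by minus the mean squared Hellinger distance between `μ` and its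
translates. So the mean is negative for small `θ` unless `μ` is invariant
(`map_eq_of_integral_log_nonneg`).

The ratios `m (s J) / m J` over all intervals `J` around `x` of length less than `ε` have a
supremum (`maxRatio`) that is bounded, because the Jacobians are, and that converges to at most
`R s x` almost everywhere as `ε → 0` (`ae_iInf_maxRatio_le`). Hence the exponent is negative already
at some scale `ε > 0`. By the maximal ergodic theorem for the skew product
(`measure_forall_birkhoffSum_nonpos_pos`), with positive probability all partial sums of the
exponents decrease linearly, and on this event a small interval stays small forever and shrinks
exponentially (`exists_measure_isContracted_pos`).

It remains to pass from `μ` to all points. Let `u l x` be the probability that a neighborhood of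
`x` is contracted at rate `l`. The zero set of `u l` is closed and forward invariant, and shrinks
as `l` decreases. If it were nonempty for every `l > 0`, the intersection over `l` would carry a
stationary measure (`exists_stationary_measure`), which cannot be invariant, contradicting the
above. So `u l` is positive everywhere for some `l`, hence bounded below by compactness, and a
zero-one law (`infinitePi_eq_zero_of_le_of_tail`) gives `u l = 1`.
-/

/-! ### The maximal ergodic theorem -/

/-- The running maximum `max (0, S₁, …, Sₙ)` of the Birkhoff sums of `g` along `T`, written as the
recursion `Mₙ₊₁ = max (0, g + Mₙ ∘ T)`. -/
def maxBirkhoff {X : Type*} (T : X → X) (g : X → ℝ) : ℕ → X → ℝ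
  | 0 => fun _ => 0
  | n + 1 => fun x => max 0 (g x + maxBirkhoff T g n (T x))

lemma maxBirkhoff_nonneg {X : Type*} (T : X → X) (g : X → ℝ) (n : ℕ) (x : X) :
    0 ≤ maxBirkhoff T g n x := by
  cases n with
  | zero => exact le_rfl
  | succ n => exact le_max_left _ _

lemma maxBirkhoff_le_succ {X : Type*} (T : X → X) (g : X → ℝ) (n : ℕ) (x : X) :
    maxBirkhoff T g n x ≤ maxBirkhoff T g (n + 1) x := by
  induction n generalizing x with
  | zero => exact le_max_left _ _
  | succ n ih => exact max_le_max le_rfl (by simpa using ih (T x))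

lemma birkhoffSum_le_maxBirkhoff {X : Type*} (T : X → X) (g : X → ℝ) (n : ℕ) (x : X) :
    birkhoffSum T g n x ≤ maxBirkhoff T g n x := by
  induction n generalizing x with
  | zero => simp [maxBirkhoff]
  | succ n ih =>
    rw [birkhoffSum_succ']
    exact le_max_of_le_right (by simpa using ih (T x))

lemma maxBirkhoff_integrable {X : Type*} [MeasurableSpace X] {μ : Measure X} {T : X → X}
    (hT : MeasurePreserving T μ μ) {g : X → ℝ} (hg : Integrable g μ) (n : ℕ) :
    Integrable (maxBirkhoff T g n) μ := by
  induction n with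
  | zero => exact integrable_zero _ _ _
  | succ n ih =>
    exact (integrable_zero _ _ _).sup (hg.add (hT.integrable_comp_of_integrable ih))

lemma maxBirkhoff_measurable {X : Type*} [MeasurableSpace X] {T : X → X}
    (hT : Measurable T) {g : X → ℝ} (hg : Measurable g) (n : ℕ) :
    Measurable (maxBirkhoff T g n) := by
  induction n with
  | zero => exact measurable_const
  | succ n ih => exact measurable_const.max (hg.add (ih.comp hT))

/-- A consequence of the maximal ergodic theorem: if `g` has negative mean, then with positive
measure all Birkhoff sums of `g` are nonpositive. -/
theorem measure_forall_birkhoffSum_nonpos_pos {X : Type*} [MeasurableSpace X] {μ : Measure X}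
    {T : X → X} (hT : MeasurePreserving T μ μ) {g : X → ℝ} (hgm : Measurable g)
    (hg : Integrable g μ) (hneg : ∫ x, g x ∂μ < 0) :
    0 < μ {x | ∀ n, birkhoffSum T g n x ≤ 0} := by
  by_contra h0
  have h0 : μ {x | ∀ n, birkhoffSum T g n x ≤ 0} = 0 := by simpa using h0
  set E : ℕ → Set X := fun n => {x | 0 < maxBirkhoff T g n x} with hE
  have hEm : ∀ n, MeasurableSet (E n) := fun n =>
    measurableSet_lt measurable_const (maxBirkhoff_measurable hT.measurable hgm n)
  have hEmono : Monotone E := monotone_nat_of_le_succ fun n x hx =>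
    lt_of_lt_of_le hx (maxBirkhoff_le_succ T g n x)
  have hEfull : ∀ᵐ x ∂μ, x ∈ ⋃ n, E n := by
    rw [ae_iff]
    refine measure_mono_null ?_ h0
    intro x hx n
    simp only [hE, Set.mem_iUnion, Set.mem_ofPred_eq, not_exists, not_lt] at hx
    exact (birkhoffSum_le_maxBirkhoff T g n x).trans (hx n)
  have key : ∀ n, 0 ≤ ∫ x in E (n + 1), g x ∂μ := by
    intro n
    have hi := maxBirkhoff_integrable hT hg
    have hle : ∀ x, maxBirkhoff T g (n + 1) x - maxBirkhoff T g n (T x) ≤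
        (E (n + 1)).indicator g x := by
      intro x
      by_cases hx : x ∈ E (n + 1)
      · rw [Set.indicator_of_mem hx]
        have hx' : 0 < max 0 (g x + maxBirkhoff T g n (T x)) := hx
        have : maxBirkhoff T g (n + 1) x = g x + maxBirkhoff T g n (T x) := by
          change max 0 _ = _
          exact max_eq_right (le_of_lt (by simpa using hx'))
        linarith
      · rw [Set.indicator_of_notMem hx]
        have h1 : maxBirkhoff T g (n + 1) x ≤ 0 := not_lt.mp hx
        linarith [maxBirkhoff_nonneg T g n (T x)]
    have hiT : Integrable (fun x => maxBirkhoff T g n (T x)) μ :=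
      hT.integrable_comp_of_integrable (hi n)
    have hcomp : ∫ x, maxBirkhoff T g n (T x) ∂μ = ∫ x, maxBirkhoff T g n x ∂μ := by
      conv_rhs => rw [← hT.map_eq]
      rw [integral_map hT.measurable.aemeasurable]
      exact (maxBirkhoff_measurable hT.measurable hgm n).aestronglyMeasurable
    rw [← integral_indicator (hEm _)]
    calc (0 : ℝ) ≤ ∫ x, maxBirkhoff T g (n + 1) x ∂μ - ∫ x, maxBirkhoff T g n x ∂μ :=
          sub_nonneg.2 (integral_mono (hi n) (hi (n + 1)) (maxBirkhoff_le_succ T g n))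
      _ = ∫ x, (maxBirkhoff T g (n + 1) x - maxBirkhoff T g n (T x)) ∂μ := by
          rw [integral_sub (hi _) hiT, hcomp]
      _ ≤ _ := integral_mono ((hi _).sub hiT) (hg.indicator (hEm _)) hle
  have hlim := tendsto_setIntegral_of_monotone hEm hEmono hg.integrableOn
  rw [Measure.restrict_eq_self_of_ae_mem hEfull] at hlim
  have := ge_of_tendsto' ((Filter.tendsto_add_atTop_iff_nat 1).2 hlim) key
  linarith

/-! ### The shift on sequences -/

/-- The sequence `s, ω 0, ω 1, …`. -/
def consSeq {ι : Type*} (s : ι) (ω : ℕ → ι) : ℕ → ι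
  | 0 => s
  | n + 1 => ω n

lemma measurable_consSeq {ι : Type*} [MeasurableSpace ι] :
    Measurable (fun q : ι × (ℕ → ι) => consSeq q.1 q.2) := by
  refine measurable_pi_lambda _ fun n => ?_
  cases n with
  | zero => exact measurable_fst
  | succ n => exact (measurable_pi_apply n).comp measurable_snd

/-- A sequence of i.i.d. variables preceded by an independent variable of the same law is again
such a sequence. -/
lemma measurePreserving_consSeq {ι : Type*} [MeasurableSpace ι] (P : Measure ι)
    [IsProbabilityMeasure P] :
    MeasurePreserving (fun q : ι × (ℕ → ι) => consSeq q.1 q.2)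
      (P.prod (Measure.infinitePi fun _ : ℕ => P)) (Measure.infinitePi fun _ : ℕ => P) := by
  classical
  refine ⟨measurable_consSeq, Measure.eq_infinitePi _ fun s t ht => ?_⟩
  -- Enlarging `s` to an initial segment, with `t i` replaced by `univ` off `s`.
  obtain ⟨n, hn⟩ : ∃ n, s ⊆ Finset.range (n + 1) :=
    ⟨s.sup id, fun i hi => by
      simpa [Nat.lt_succ_iff] using Finset.le_sup (f := id) hi⟩
  set t' : ℕ → Set ι := fun i => if i ∈ s then t i else Set.univ with ht'
  have ht'm : ∀ i, MeasurableSet (t' i) := fun i => by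
    simp only [ht']; split_ifs; exacts [ht i, .univ]
  have hpi : Set.pi (s : Set ℕ) t = Set.pi (Finset.range (n + 1) : Set ℕ) t' := by
    ext ω
    simp only [Set.mem_pi, Finset.mem_coe, ht']
    constructor
    · intro h i _
      split_ifs with hi
      exacts [h i hi, trivial]
    · intro h i hi
      simpa [hi] using h i (hn hi)
  have hprod : ∏ i ∈ s, P (t i) = ∏ i ∈ Finset.range (n + 1), P (t' i) := by
    refine Finset.prod_subset_one_on_sdiff hn (fun i hi => ?_) (fun i hi => ?_)
    · simp [ht', (Finset.mem_sdiff.1 hi).2]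
    · simp [ht', hi]
  have hpre : (fun q : ι × (ℕ → ι) => consSeq q.1 q.2) ⁻¹'
      (Set.pi (Finset.range (n + 1) : Set ℕ) t') =
      t' 0 ×ˢ Set.pi (Finset.range n : Set ℕ) (fun i => t' (i + 1)) := by
    ext q
    simp only [Set.mem_preimage, Set.mem_pi, Finset.mem_coe, Finset.mem_range, Set.mem_prod]
    constructor
    · exact fun h => ⟨h 0 (by omega), fun i hi => h (i + 1) (by omega)⟩
    · rintro ⟨h0, h⟩ i hi
      cases i with
      | zero => exact h0
      | succ i => exact h i (by omega)
  rw [hpi, Measure.map_apply measurable_consSeq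
    (MeasurableSet.pi (Finset.countable_toSet _) fun i _ => ht'm i), hpre, Measure.prod_prod,
    Measure.infinitePi_pi _ (fun i _ => ht'm (i + 1)), hprod, Finset.prod_range_succ', mul_comm]

lemma infinitePi_eq_sum_consSeq {ι : Type*} [Fintype ι] [MeasurableSpace ι]
    [DiscreteMeasurableSpace ι] (P : Measure ι) [IsProbabilityMeasure P] {A : Set (ℕ → ι)}
    (hA : MeasurableSet A) :
    Measure.infinitePi (fun _ : ℕ => P) A =
      ∑ s, P {s} * Measure.infinitePi (fun _ : ℕ => P) {ω | consSeq s ω ∈ A} := by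
  conv_lhs => rw [← (measurePreserving_consSeq P).map_eq]
  rw [Measure.map_apply measurable_consSeq hA, Measure.prod_apply (measurable_consSeq hA),
    lintegral_fintype]
  exact Finset.sum_congr rfl fun s _ => mul_comm _ _

/-- A zero-one law: let `N x` be events indexed by the starting point `x` of a random walk that
depend only on the tail of the trajectory, in the sense of `hN`. If their probabilities are bounded
away from `1`, they are null. Conditioning on the first `n` steps gives
`ℙ (N x ∩ A) ≤ r ℙ A` for every event `A` that depends on finitely many steps, hence for `A = N x`
by approximation. -/
theorem infinitePi_eq_zero_of_le_of_tail {ι X : Type*} [Fintype ι] [MeasurableSpace ι]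
    [DiscreteMeasurableSpace ι] (P : Measure ι) [IsProbabilityMeasure P] (act : ι → X → X)
    (N : X → Set (ℕ → ι)) (hNm : ∀ x, MeasurableSet (N x))
    (hN : ∀ x s ω, consSeq s ω ∈ N x ↔ ω ∈ N (act s x)) {r : ENNReal} (hr : r < 1)
    (hle : ∀ x, Measure.infinitePi (fun _ : ℕ => P) (N x) ≤ r) (x : X) :
    Measure.infinitePi (fun _ : ℕ => P) (N x) = 0 := by
  set Q := Measure.infinitePi (fun _ : ℕ => P) with hQ
  have step : ∀ n : ℕ, ∀ x : X, ∀ A : Set (ℕ → ι), MeasurableSet A →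
      (∀ ω ω' : ℕ → ι, (∀ i < n, ω i = ω' i) → (ω ∈ A ↔ ω' ∈ A)) → Q (N x ∩ A) ≤ r * Q A := by
    intro n
    induction n with
    | zero =>
      intro x A _ hdep
      rcases A.eq_empty_or_nonempty with rfl | ⟨a, ha⟩
      · simp
      · have : A = Set.univ := Set.eq_univ_of_forall fun ω => (hdep a ω (by simp)).1 ha
        simpa [this] using hle x
    | succ n ih =>
      intro x A hA hdep
      have hcm : ∀ s : ι, Measurable (fun ω : ℕ → ι => consSeq s ω) := fun s =>
        measurable_consSeq.comp measurable_prodMk_left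
      rw [hQ, infinitePi_eq_sum_consSeq P ((hNm x).inter hA), infinitePi_eq_sum_consSeq P hA,
        Finset.mul_sum]
      refine Finset.sum_le_sum fun s _ => ?_
      have h1 : {ω | consSeq s ω ∈ N x ∩ A} = N (act s x) ∩ {ω | consSeq s ω ∈ A} := by
        ext ω
        simp only [Set.mem_ofPred_eq, Set.mem_inter_iff, hN]
      rw [h1, mul_left_comm]
      gcongr
      refine ih _ _ (hcm s hA) fun ω ω' h => hdep _ _ fun i hi => ?_
      cases i with
      | zero => rfl
      | succ i => exact h i (by omega)
  have happrox : ∀ ε : ENNReal, 0 < ε → Q (N x) ≤ r * (Q (N x) + ε) + ε := by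
    intro ε hε
    obtain ⟨t, ht, hlt⟩ := exists_measure_symmDiff_lt_of_generateFrom_isSetRing (μ := Q)
      (isSetRing_measurableCylinders (α := fun _ : ℕ => ι))
      ⟨{Set.univ}, by simp, by simpa using ⟨∅, Set.univ, .univ, (cylinder_univ _).symm⟩, by simp⟩
      (generateFrom_measurableCylinders).symm (hNm x) hε
    obtain ⟨I, T, hT, rfl⟩ := (mem_measurableCylinders _).1 ht
    have h1 : Q (N x ∩ cylinder I T) ≤ r * Q (cylinder I T) := by
      refine step (I.sup id + 1) x _ (MeasurableSet.cylinder I hT) fun ω ω' h => ?_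
      have : I.restrict ω = I.restrict ω' := by
        funext i
        exact h i (Nat.lt_succ_of_le (Finset.le_sup (f := id) i.2))
      simp only [mem_cylinder, this]
    have h2 : Q (N x) ≤ Q (N x ∩ cylinder I T) + ε := by
      refine (measure_le_inter_add_sdiff Q _ (cylinder I T)).trans ?_
      gcongr
      exact (measure_mono (by rw [Set.symmDiff_def]; exact Set.subset_union_right)).trans hlt.le
    have h3 : Q (cylinder I T) ≤ Q (N x) + ε := by
      refine (measure_le_inter_add_sdiff Q _ (N x)).trans ?_
      gcongr
      · exact Set.inter_subset_right
      · exact (measure_mono (by rw [Set.symmDiff_def]; exact Set.subset_union_left)).trans hlt.le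
    calc Q (N x) ≤ r * Q (cylinder I T) + ε := h2.trans (by gcongr)
      _ ≤ _ := by gcongr
  have hfin : Q (N x) ≠ ⊤ := measure_ne_top _ _
  have hrfin : r ≠ ⊤ := hr.ne_top
  have hreal : (Q (N x)).toReal ≤ r.toReal * (Q (N x)).toReal := by
    refine le_of_forall_pos_le_add fun ε hε => ?_
    have h := happrox (ENNReal.ofReal (ε / 2)) (by simpa using hε)
    have h' := ENNReal.toReal_mono (by finiteness) h
    rw [ENNReal.toReal_add (by finiteness) (by finiteness), ENNReal.toReal_mul,
      ENNReal.toReal_add hfin (by finiteness), ENNReal.toReal_ofReal (by positivity)] at h'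
    have hr1 : r.toReal ≤ 1 := by
      simpa using ENNReal.toReal_mono ENNReal.one_ne_top hr.le
    nlinarith
  have hr1 : r.toReal < 1 := by
    simpa using (ENNReal.toReal_lt_toReal hrfin ENNReal.one_ne_top).2 hr
  have h0 : (Q (N x)).toReal = 0 := by
    have := ENNReal.toReal_nonneg (a := Q (N x))
    nlinarith
  exact (ENNReal.toReal_eq_zero_iff _).1 h0 |>.resolve_right hfin

/-! ### Stationary measures -/

/-- The law of `f s x` when `s` has law `P` and `x` has law `ν`, independently. -/
noncomputable def stepLaw {ι X : Type*} [MeasurableSpace ι] [MeasurableSpace X]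
    (P : Measure ι) (f : ι → X → X) (ν : Measure X) : Measure X :=
  (P.prod ν).map fun q => f q.1 q.2

section Stationary

variable {ι X : Type*} [Fintype ι] [MeasurableSpace ι] [DiscreteMeasurableSpace ι]
  [MeasurableSpace X] (P : Measure ι) {f : ι → X → X}

lemma measurable_uncurry_of_discrete (hf : ∀ s, Measurable (f s)) :
    Measurable fun q : ι × X => f q.1 q.2 :=
  measurable_from_prod_countable_right hf

lemma isProbabilityMeasure_stepLaw [IsProbabilityMeasure P] (hf : ∀ s, Measurable (f s))
    (ν : Measure X) [IsProbabilityMeasure ν] : IsProbabilityMeasure (stepLaw P f ν) :=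
  Measure.isProbabilityMeasure_map (measurable_uncurry_of_discrete hf).aemeasurable

lemma integral_stepLaw [IsProbabilityMeasure P] (hf : ∀ s, Measurable (f s)) (ν : Measure X)
    [IsFiniteMeasure ν] {φ : X → ℝ} (hφ : Measurable φ)
    (hφi : ∀ s, Integrable (fun x => φ (f s x)) ν) :
    ∫ x, φ x ∂(stepLaw P f ν) = ∑ s, P.real {s} * ∫ x, φ (f s x) ∂ν := by
  have hm := measurable_uncurry_of_discrete (f := f) hf
  rw [stepLaw, integral_map hm.aemeasurable hφ.aestronglyMeasurable, integral_prod]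
  · rw [integral_fintype (.of_finite)]
    simp
  · refine (integrable_prod_iff (hφ.comp hm).aestronglyMeasurable).2 ⟨.of_forall hφi, .of_finite⟩

lemma lintegral_stepLaw (hf : ∀ s, Measurable (f s)) (ν : Measure X) [IsFiniteMeasure ν]
    {φ : X → ENNReal} (hφ : Measurable φ) :
    ∫⁻ x, φ x ∂(stepLaw P f ν) = ∑ s, P {s} * ∫⁻ x, φ (f s x) ∂ν := by
  have hm := measurable_uncurry_of_discrete (f := f) hf
  rw [stepLaw, lintegral_map hφ hm,
    lintegral_prod (fun q : ι × X => φ (f q.1 q.2)) (hφ.comp hm).aemeasurable, lintegral_fintype]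
  exact Finset.sum_congr rfl fun s _ => mul_comm _ _

lemma stepLaw_apply (hf : ∀ s, Measurable (f s)) (ν : Measure X) [IsFiniteMeasure ν]
    {A : Set X} (hA : MeasurableSet A) :
    stepLaw P f ν A = ∑ s, P {s} * ν (f s ⁻¹' A) := by
  have h := lintegral_stepLaw P hf ν (φ := A.indicator 1) (measurable_one.indicator hA)
  rw [lintegral_indicator_one hA] at h
  rw [h]
  refine Finset.sum_congr rfl fun s _ => ?_
  rw [← lintegral_indicator_one (hf s hA)]
  rfl

/-- The Krylov–Bogoliubov theorem for a random walk: a nonempty closed subset `M` of a compact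
space that is forward invariant carries a stationary probability measure. -/
theorem exists_stationary_measure [IsProbabilityMeasure P] [MetricSpace X] [CompactSpace X]
    [BorelSpace X] (hf : ∀ s, Continuous (f s)) {M : Set X} (hM : IsClosed M) (hne : M.Nonempty)
    (hfM : ∀ s, ∀ x ∈ M, f s x ∈ M) :
    ∃ μ : Measure X, IsProbabilityMeasure μ ∧ stepLaw P f μ = μ ∧ μ Mᶜ = 0 := by
  obtain ⟨x₀, hx₀⟩ := hne
  have hfm : ∀ s, Measurable (f s) := fun s => (hf s).measurable
  set ν : ℕ → Measure X := fun n => (stepLaw P f)^[n] (Measure.dirac x₀) with hν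
  have hν_succ : ∀ n, ν (n + 1) = stepLaw P f (ν n) := fun n => by
    simp only [hν, Function.iterate_succ_apply']
  have hνp : ∀ n, IsProbabilityMeasure (ν n) := by
    intro n
    induction n with
    | zero => exact Measure.dirac.isProbabilityMeasure
    | succ n ih => rw [hν_succ]; exact isProbabilityMeasure_stepLaw P hfm _
  have hνM : ∀ n, ν n Mᶜ = 0 := by
    intro n
    induction n with
    | zero =>
      change Measure.dirac x₀ Mᶜ = 0
      rw [Measure.dirac_apply' _ hM.measurableSet.compl]
      simp [hx₀]
    | succ n ih =>
      rw [hν_succ, stepLaw_apply P hfm _ hM.measurableSet.compl]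
      refine Finset.sum_eq_zero fun s _ => ?_
      rw [measure_mono_null _ ih, mul_zero]
      intro x hx hxM
      exact hx (hfM s x hxM)
  -- The Cesàro means of the laws of the walk started at `x₀`.
  set avg : ℕ → Measure X :=
    fun n => (n + 1 : ENNReal)⁻¹ • ∑ k ∈ Finset.range (n + 1), ν k with havg
  have havgp : ∀ n, IsProbabilityMeasure (avg n) := fun n => ⟨by
    simp only [havg, Measure.smul_apply, Measure.coe_finsetSum, Finset.sum_apply, measure_univ,
      Finset.sum_const, Finset.card_range, smul_eq_mul, nsmul_eq_mul, mul_one]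
    push_cast
    exact ENNReal.inv_mul_cancel (by simp) (by finiteness)⟩
  have hint : ∀ (φ : BoundedContinuousFunction X ℝ) n,
      ∫ x, φ x ∂(avg n) = (n + 1 : ℝ)⁻¹ * ∑ k ∈ Finset.range (n + 1), ∫ x, φ x ∂(ν k) := by
    intro φ n
    simp only [havg]
    rw [integral_smul_measure, integral_finsetSum_measure fun k _ => φ.integrable _]
    congr 1
    rw [ENNReal.toReal_inv]
    norm_cast
  let a : ℕ → ProbabilityMeasure X := fun n => ⟨avg n, havgp n⟩
  set F : Ultrafilter (ProbabilityMeasure X) := (Filter.hyperfilter ℕ).map a with hF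
  have hlim : Filter.Tendsto a (Filter.hyperfilter ℕ) (𝓝 F.lim) := F.le_nhds_lim
  rw [ProbabilityMeasure.tendsto_iff_forall_integral_tendsto] at hlim
  set μ : Measure X := (F.lim : Measure X) with hμ
  have hμp : IsProbabilityMeasure μ := (F.lim).2
  refine ⟨μ, hμp, ?_, ?_⟩
  · have := isProbabilityMeasure_stepLaw P hfm μ
    refine ext_of_forall_integral_eq_of_IsFiniteMeasure fun φ => ?_
    -- The image of `φ` by the Markov operator of the walk.
    let ψ : BoundedContinuousFunction X ℝ := BoundedContinuousFunction.mkOfCompact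
      ⟨fun x => ∑ s, P.real {s} * φ (f s x), by fun_prop⟩
    have hψ : ∀ (ρ : Measure X) [IsProbabilityMeasure ρ],
        ∫ x, φ x ∂(stepLaw P f ρ) = ∫ x, ψ x ∂ρ := by
      intro ρ _
      have hi : ∀ s, Integrable (fun x => φ (f s x)) ρ := fun s =>
        (φ.compContinuous ⟨f s, hf s⟩).integrable ρ
      rw [integral_stepLaw P hfm ρ φ.continuous.measurable hi]
      change _ = ∫ x, ∑ s, P.real {s} * φ (f s x) ∂ρ
      rw [integral_finsetSum _ fun s _ => (hi s).const_mul _]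
      simp only [integral_const_mul]
    rw [hψ μ]
    have hdiff : Filter.Tendsto (fun n => ∫ x, ψ x ∂(avg n) - ∫ x, φ x ∂(avg n))
        (Filter.hyperfilter ℕ) (𝓝 0) := by
      have h1 : ∀ n, ∫ x, ψ x ∂(avg n) - ∫ x, φ x ∂(avg n) =
          (n + 1 : ℝ)⁻¹ * (∫ x, φ x ∂(ν (n + 1)) - ∫ x, φ x ∂(ν 0)) := by
        intro n
        rw [hint, hint, ← mul_sub, ← Finset.sum_sub_distrib,
          ← Finset.sum_range_sub (fun k => ∫ x, φ x ∂(ν k))]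
        congr 1
        refine Finset.sum_congr rfl fun k _ => ?_
        have := hνp k
        rw [hν_succ, hψ]
      simp only [h1]
      refine Filter.Tendsto.mono_left ?_ Nat.hyperfilter_le_atTop
      refine Filter.Tendsto.zero_mul_isBoundedUnder_le ?_ ?_
      · exact (tendsto_one_div_add_atTop_nhds_zero_nat (𝕜 := ℝ)).congr fun n => one_div _
      · refine Filter.isBoundedUnder_of ⟨‖φ‖ + ‖φ‖, fun n => ?_⟩
        have hb : ∀ k, ‖∫ x, φ x ∂(ν k)‖ ≤ ‖φ‖ := fun k => by
          have := hνp k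
          exact φ.norm_integral_le_norm _
        exact (norm_sub_le _ _).trans (add_le_add (hb _) (hb _))
    have := tendsto_nhds_unique hdiff ((hlim ψ).sub (hlim φ))
    exact (sub_eq_zero.1 this.symm)
  · have hφ : Continuous fun x => Metric.infDist x M := Metric.continuous_infDist_pt M
    let φ : BoundedContinuousFunction X ℝ := BoundedContinuousFunction.mkOfCompact ⟨_, hφ⟩
    have h0 : ∀ n, ∫ x, φ x ∂(avg n) = 0 := by
      intro n
      rw [hint, Finset.sum_eq_zero, mul_zero]
      intro k _
      refine integral_eq_zero_of_ae ?_
      have : ∀ᵐ x ∂(ν k), x ∈ M := hνM k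
      filter_upwards [this] with x hx
      exact Metric.infDist_zero_of_mem hx
    have hμ0 : ∫ x, φ x ∂μ = 0 :=
      tendsto_nhds_unique (hlim φ) (tendsto_const_nhds.congr fun n => (h0 n).symm)
    have hae := (integral_eq_zero_iff_of_nonneg (f := φ) (fun x => Metric.infDist_nonneg)
      (φ.integrable μ)).1 hμ0
    have : ∀ᵐ x ∂μ, x ∈ M := by
      filter_upwards [hae] with x hx
      exact (hM.mem_iff_infDist_zero ⟨x₀, hx₀⟩).2 hx
    exact this

end Stationary

/-! ### Differentiation of measures along intervals -/

/-- From a finite family of open intervals one can extract a family with the same union such that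
no point lies in three of its members. -/
lemma exists_subfamily_overlap_le_two (I : Finset (ℝ × ℝ)) :
    ∃ I' ⊆ I, (∀ z : ℝ, (∃ p ∈ I, z ∈ Set.Ioo p.1 p.2) → ∃ p ∈ I', z ∈ Set.Ioo p.1 p.2) ∧
      ∀ z : ℝ, (I'.filter fun p => p.1 < z ∧ z < p.2).card ≤ 2 := by
  classical
  induction I using Finset.strongInduction with
  | H I ih =>
    by_cases h : ∀ z : ℝ, (I.filter fun p => p.1 < z ∧ z < p.2).card ≤ 2
    · exact ⟨I, subset_rfl, fun z hz => hz, h⟩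
    push Not at h
    obtain ⟨x, hx⟩ := h
    set T := I.filter fun p => p.1 < x ∧ x < p.2 with hT
    have hTne : T.Nonempty := Finset.card_pos.1 (by omega)
    -- Among the intervals containing `x`, the one reaching furthest to the left and the one
    -- reaching furthest to the right cover all others.
    obtain ⟨p, hpT, hp⟩ := T.exists_min_image Prod.fst hTne
    obtain ⟨q, hqT, hq⟩ := T.exists_max_image Prod.snd hTne
    obtain ⟨r, hrT, hr⟩ : ∃ r ∈ T, r ∉ ({p, q} : Finset (ℝ × ℝ)) :=
      Finset.exists_mem_notMem_of_card_lt_card (lt_of_le_of_lt Finset.card_le_two hx)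
    simp only [Finset.mem_insert, Finset.mem_singleton, not_or] at hr
    have hp' := Finset.mem_filter.1 hpT
    have hq' := Finset.mem_filter.1 hqT
    have hr' := Finset.mem_filter.1 hrT
    obtain ⟨I', hI', hcov, hcard⟩ := ih (I.erase r) (Finset.erase_ssubset hr'.1)
    refine ⟨I', hI'.trans (Finset.erase_subset _ _), fun z hz => hcov z ?_, hcard⟩
    obtain ⟨s, hsI, hs⟩ := hz
    by_cases hsr : s = r
    · subst hsr
      rcases le_or_gt z x with hzx | hzx
      · exact ⟨p, Finset.mem_erase.2 ⟨Ne.symm hr.1, hp'.1⟩,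
          lt_of_le_of_lt (hp s hrT) hs.1, lt_of_le_of_lt hzx hp'.2.2⟩
      · exact ⟨q, Finset.mem_erase.2 ⟨Ne.symm hr.2, hq'.1⟩,
          hq'.2.1.trans hzx, lt_of_lt_of_le hs.2 (hq s hrT)⟩
    · exact ⟨s, Finset.mem_erase.2 ⟨hsr, hsI⟩, hs⟩

section Differentiation

variable {K : Set ℝ}

/-- The trace on `K` of the open interval `(a, b)`. -/
def traceIoo (K : Set ℝ) (a b : ℝ) : Set K := {z | a < z ∧ (z : ℝ) < b}

lemma isOpen_traceIoo (a b : ℝ) : IsOpen (traceIoo K a b) :=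
  (isOpen_lt continuous_const continuous_subtype_val).inter
    (isOpen_lt continuous_subtype_val continuous_const)

lemma measurableSet_traceIoo (a b : ℝ) : MeasurableSet (traceIoo K a b) :=
  (isOpen_traceIoo a b).measurableSet

/-- A Vitali-type maximal inequality for two arbitrary finite measures: if `t * m J ≤ ν J` for
arbitrarily small intervals `J` around every point of `E`, then `t * m E ≤ 2 * ν E`. No doubling
condition is needed on the line, since overlaps can be reduced to two. -/
lemma mul_measure_le_of_fine_cover [CompactSpace K] (m ν : Measure K) [IsFiniteMeasure m]
    [IsFiniteMeasure ν] {t : ENNReal} {E : Set K} (hE : MeasurableSet E)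
    (h : ∀ x ∈ E, ∀ ε > 0, ∃ a b : ℝ, x ∈ traceIoo K a b ∧ b - a < ε ∧
      t * m (traceIoo K a b) ≤ ν (traceIoo K a b)) :
    t * m E ≤ 2 * ν E := by
  classical
  rw [E.measure_eq_iInf_isOpen ν, ENNReal.mul_iInf_of_ne (by simp) (by simp)]
  refine le_iInf fun V => ?_
  rw [ENNReal.mul_iInf' (by simp) (by simp)]
  refine le_iInf fun hEV => ?_
  rw [ENNReal.mul_iInf' (by simp) (by simp)]
  refine le_iInf fun hV => ?_
  rw [hE.measure_eq_iSup_isCompact_of_ne_top (measure_ne_top m E), ENNReal.mul_iSup]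
  refine iSup_le fun A => ?_
  rw [ENNReal.mul_iSup]
  refine iSup_le fun hAE => ?_
  rw [ENNReal.mul_iSup]
  refine iSup_le fun hA => ?_
  have hloc : ∀ x ∈ A, ∃ p : ℝ × ℝ, x ∈ traceIoo K p.1 p.2 ∧ traceIoo K p.1 p.2 ⊆ V ∧
      t * m (traceIoo K p.1 p.2) ≤ ν (traceIoo K p.1 p.2) := by
    intro x hx
    obtain ⟨δ, hδ, hball⟩ := Metric.isOpen_iff.1 hV x (hEV (hAE hx))
    obtain ⟨a, b, hxab, hab, hle⟩ := h x (hAE hx) δ hδ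
    refine ⟨(a, b), hxab, fun z hz => hball ?_, hle⟩
    rw [Metric.mem_ball, Subtype.dist_eq, Real.dist_eq, abs_lt]
    constructor <;> linarith [hz.1, hz.2, hxab.1, hxab.2]
  choose! p hpx hpV hple using hloc
  obtain ⟨s, hsA, hs⟩ := hA.elim_nhds_subcover (fun x => traceIoo K (p x).1 (p x).2)
    fun x hx => (isOpen_traceIoo _ _).mem_nhds (hpx x hx)
  obtain ⟨I, hI, hcov, hcard⟩ := exists_subfamily_overlap_le_two (s.image p)
  have hIp : ∀ q ∈ I, traceIoo K q.1 q.2 ⊆ V ∧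
      t * m (traceIoo K q.1 q.2) ≤ ν (traceIoo K q.1 q.2) := by
    intro q hq
    obtain ⟨x, hx, rfl⟩ := Finset.mem_image.1 (hI hq)
    exact ⟨hpV x (hsA x hx), hple x (hsA x hx)⟩
  have hAI : A ⊆ ⋃ q ∈ I, traceIoo K q.1 q.2 := by
    intro z hz
    obtain ⟨x, hx, hzx⟩ := Set.mem_iUnion₂.1 (hs hz)
    obtain ⟨q, hq, hzq⟩ := hcov z ⟨p x, Finset.mem_image_of_mem p hx, hzx⟩
    exact Set.mem_iUnion₂.2 ⟨q, hq, hzq⟩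
  calc t * m A ≤ t * ∑ q ∈ I, m (traceIoo K q.1 q.2) := by
        gcongr
        exact (measure_mono hAI).trans (measure_biUnion_finset_le _ _)
    _ = ∑ q ∈ I, t * m (traceIoo K q.1 q.2) := Finset.mul_sum _ _ _
    _ ≤ ∑ q ∈ I, ν (traceIoo K q.1 q.2) := Finset.sum_le_sum fun q hq => (hIp q hq).2
    _ = ∫⁻ z, ∑ q ∈ I, (traceIoo K q.1 q.2).indicator 1 z ∂ν := by
        rw [lintegral_finsetSum _ fun q _ =>
          measurable_one.indicator (measurableSet_traceIoo q.1 q.2)]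
        refine Finset.sum_congr rfl fun q _ => ?_
        rw [lintegral_indicator_one (measurableSet_traceIoo q.1 q.2)]
    _ ≤ ∫⁻ z, V.indicator (fun _ => 2) z ∂ν := by
        refine lintegral_mono fun z => ?_
        by_cases hz : z ∈ V
        · rw [Set.indicator_of_mem hz]
          have : ∑ q ∈ I, (traceIoo K q.1 q.2).indicator (1 : K → ENNReal) z =
              (I.filter fun q => q.1 < (z : ℝ) ∧ (z : ℝ) < q.2).card := by
            rw [Finset.card_filter, Nat.cast_sum]
            refine Finset.sum_congr rfl fun q _ => ?_
            by_cases hq : z ∈ traceIoo K q.1 q.2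
            · have hq' : q.1 < (z : ℝ) ∧ (z : ℝ) < q.2 := hq
              rw [Set.indicator_of_mem hq, if_pos hq']
              simp
            · have hq' : ¬ (q.1 < (z : ℝ) ∧ (z : ℝ) < q.2) := hq
              rw [Set.indicator_of_notMem hq, if_neg hq']
              simp
          rw [this]
          exact (Nat.cast_le (α := ENNReal)).2 (hcard z)
        · rw [Finset.sum_eq_zero fun q hq => Set.indicator_of_notMem
            (fun hzq => hz ((hIp q hq).1 hzq)) _]
          exact zero_le
    _ = 2 * ν V := by
        rw [lintegral_indicator hV.measurableSet, setLIntegral_const]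

/-- The supremum of the ratios `ν J / m J` over the open intervals `J` of length less than `ε`
around `x`. -/
noncomputable def maxRatio (ν m : Measure K) (ε : ℝ) (x : K) : ENNReal :=
  ⨆ (a : ℝ) (b : ℝ) (_ : b - a < ε) (_ : x ∈ traceIoo K a b),
    ν (traceIoo K a b) / m (traceIoo K a b)

lemma lt_maxRatio_iff {ν m : Measure K} {ε : ℝ} {x : K} {t : ENNReal} :
    t < maxRatio ν m ε x ↔ ∃ a b : ℝ, b - a < ε ∧ x ∈ traceIoo K a b ∧
      t < ν (traceIoo K a b) / m (traceIoo K a b) := by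
  simp only [maxRatio, lt_iSup_iff, exists_prop]

lemma measurable_maxRatio (ν m : Measure K) (ε : ℝ) : Measurable (maxRatio ν m ε) := by
  refine measurable_of_Ioi fun t => IsOpen.measurableSet ?_
  have : maxRatio ν m ε ⁻¹' Set.Ioi t = ⋃ (a : ℝ) (b : ℝ) (_ : b - a < ε)
      (_ : t < ν (traceIoo K a b) / m (traceIoo K a b)), traceIoo K a b := by
    ext x
    simp only [Set.mem_preimage, Set.mem_Ioi, lt_maxRatio_iff, Set.mem_iUnion, exists_prop]
    grind
  rw [this]
  exact isOpen_iUnion fun a => isOpen_iUnion fun b => isOpen_iUnion fun _ => isOpen_iUnion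
    fun _ => isOpen_traceIoo a b

lemma maxRatio_mono (ν m : Measure K) {ε ε' : ℝ} (h : ε ≤ ε') (x : K) :
    maxRatio ν m ε x ≤ maxRatio ν m ε' x := by
  refine le_of_forall_lt fun t ht => ?_
  obtain ⟨a, b, hab, hx, hlt⟩ := lt_maxRatio_iff.1 ht
  exact lt_maxRatio_iff.2 ⟨a, b, hab.trans_le h, hx, hlt⟩

lemma maxRatio_le {ν m : Measure K} {C : ENNReal} (hC : ν ≤ C • m) (ε : ℝ) (x : K) :
    maxRatio ν m ε x ≤ C := by
  refine iSup_le fun a => iSup_le fun b => iSup_le fun _ => iSup_le fun _ => ?_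
  exact ENNReal.div_le_of_le_mul (by simpa using hC (traceIoo K a b))

lemma measure_uIcc_le_maxRatio_mul {ν m : Measure K} [IsFiniteMeasure m] {C : ENNReal}
    (hCtop : C ≠ ⊤) (hC : ν ≤ C • m) {ε : ℝ} {x y : K} (hxy : dist x y < ε) :
    ν (Set.uIcc x y) ≤ maxRatio ν m ε x * m (Set.uIcc x y) := by
  set R := maxRatio ν m ε x with hR
  have hRtop : R ≠ ⊤ := ne_top_of_le_ne_top hCtop (maxRatio_le hC ε x)
  -- The closed interval is the decreasing limit of slightly larger open ones.
  set J : ℕ → Set K := fun n =>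
    traceIoo K (min (x : ℝ) y - 1 / ((n : ℝ) + 1)) (max (x : ℝ) y + 1 / ((n : ℝ) + 1)) with hJ
  have hmem : ∀ z : K, z ∈ Set.uIcc x y ↔ min (x : ℝ) y ≤ z ∧ (z : ℝ) ≤ max (x : ℝ) y := by
    intro z
    rcases le_total x y with h | h
    · have h' : (x : ℝ) ≤ y := h
      rw [Set.uIcc_of_le h, min_eq_left h', max_eq_right h']
      exact Iff.rfl
    · have h' : (y : ℝ) ≤ x := h
      rw [Set.uIcc_of_ge h, min_eq_right h', max_eq_left h']
      exact Iff.rfl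
  have hsub : ∀ n, Set.uIcc x y ⊆ J n := by
    intro n z hz
    have h1 := (hmem z).1 hz
    have h2 : (0 : ℝ) < 1 / ((n : ℝ) + 1) := by positivity
    exact ⟨by linarith [h1.1], by linarith [h1.2]⟩
  have hanti : Antitone J := by
    intro i j hij z hz
    have h2 : 1 / ((j : ℝ) + 1) ≤ 1 / ((i : ℝ) + 1) := Nat.one_div_le_one_div hij
    exact ⟨by linarith [hz.1], by linarith [hz.2]⟩
  have hInter : ⋂ n, J n = Set.uIcc x y := by
    refine subset_antisymm (fun z hz => (hmem z).2 ?_) (Set.subset_iInter hsub)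
    rw [Set.mem_iInter] at hz
    have hlim := tendsto_one_div_add_atTop_nhds_zero_nat (𝕜 := ℝ)
    constructor
    · have := le_of_tendsto' (hlim.const_sub (min (x : ℝ) y)) fun n => (hz n).1.le
      simpa using this
    · have := ge_of_tendsto' (hlim.const_add (max (x : ℝ) y)) fun n => (hz n).2.le
      simpa using this
  have hlim : Filter.Tendsto (fun n => m (J n)) Filter.atTop (𝓝 (m (Set.uIcc x y))) := by
    rw [← hInter]
    exact tendsto_measure_iInter_atTop
      (fun n => (measurableSet_traceIoo _ _).nullMeasurableSet) hanti ⟨0, measure_ne_top _ _⟩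
  refine ge_of_tendsto (ENNReal.Tendsto.const_mul hlim (Or.inr hRtop)) ?_
  have hsmall : ∀ᶠ n : ℕ in Filter.atTop, 1 / ((n : ℝ) + 1) < (ε - dist x y) / 2 :=
    (tendsto_one_div_add_atTop_nhds_zero_nat (𝕜 := ℝ)).eventually_lt_const (by linarith)
  filter_upwards [hsmall] with n hn
  have hlen : (max (x : ℝ) y + 1 / ((n : ℝ) + 1)) - (min (x : ℝ) y - 1 / ((n : ℝ) + 1)) < ε := by
    have : max (x : ℝ) y - min (x : ℝ) y = dist x y := by
      rw [max_sub_min_eq_abs', Subtype.dist_eq, Real.dist_eq]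
    linarith
  have hle : ν (J n) / m (J n) ≤ R :=
    le_iSup₂_of_le _ _ (le_iSup₂_of_le hlen (hsub n Set.left_mem_uIcc) le_rfl)
  refine (measure_mono (hsub n)).trans ?_
  by_cases h0 : m (J n) = 0
  · have : ν (J n) ≤ C * m (J n) := by simpa using hC (J n)
    simpa [h0] using this
  · exact (ENNReal.div_le_iff h0 (measure_ne_top _ _)).1 hle

/-- One half of the Lebesgue differentiation theorem along (not necessarily centered) intervals,
with respect to an arbitrary finite measure on a compact subset of the line. -/
theorem ae_iInf_maxRatio_le [CompactSpace K] {m : Measure K} [IsFiniteMeasure m] {h : K → ENNReal}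
    (hh : Measurable h) [IsFiniteMeasure (m.withDensity h)] :
    ∀ᵐ x ∂m, ⨅ n : ℕ, maxRatio (m.withDensity h) m (1 / ((n : ℝ) + 1)) x ≤ h x := by
  set ν := m.withDensity h with hν
  have hRm : Measurable fun x => ⨅ n : ℕ, maxRatio ν m (1 / ((n : ℝ) + 1)) x :=
    Measurable.iInf fun n => measurable_maxRatio _ _ _
  have key : ∀ r r' : ℚ, r < r' → 0 ≤ r → ∀ᵐ x ∂m, ¬ (h x < (Real.toNNReal r : ENNReal) ∧
      (Real.toNNReal r' : ENNReal) < ⨅ n : ℕ, maxRatio ν m (1 / ((n : ℝ) + 1)) x) := by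
    intro r r' hrr hr0
    set a : ENNReal := (Real.toNNReal r : ENNReal)
    set b : ENNReal := (Real.toNNReal r' : ENNReal)
    have hab : a < b := by
      simp only [a, b, ENNReal.coe_lt_coe]
      refine (Real.toNNReal_lt_toNNReal_iff ?_).2 (by exact_mod_cast hrr)
      exact_mod_cast hr0.trans_lt hrr
    set E : Set K := {x | h x < a ∧ b < ⨅ n : ℕ, maxRatio ν m (1 / ((n : ℝ) + 1)) x} with hE
    have hEm : MeasurableSet E :=
      (measurableSet_lt hh measurable_const).inter (measurableSet_lt measurable_const hRm)
    -- The part of `ν` exceeding `a • m`; it does not charge `E`.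
    set ν' := m.withDensity (fun x => h x - a) with hν'
    have hνν' : ∀ A, MeasurableSet A → ν A ≤ a * m A + ν' A := by
      intro A hA
      rw [hν, hν', withDensity_apply _ hA, withDensity_apply _ hA, ← setLIntegral_const,
        ← lintegral_add_left measurable_const]
      exact lintegral_mono fun x => le_add_tsub
    have : IsFiniteMeasure ν' := ⟨lt_of_le_of_lt
      (withDensity_mono (.of_forall fun x => tsub_le_self) Set.univ) (measure_lt_top ν _)⟩
    have hν'E : ν' E = 0 := by
      rw [hν', withDensity_apply _ hEm]
      refine setLIntegral_eq_zero hEm fun x hx => ?_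
      exact tsub_eq_zero_of_le hx.1.le
    have hmul := mul_measure_le_of_fine_cover m ν' (t := b - a) hEm fun x hx ε hε => by
      obtain ⟨n, hn⟩ := exists_nat_one_div_lt hε
      obtain ⟨c, d, hcd, hxcd, hlt⟩ := lt_maxRatio_iff.1 (hx.2.trans_le (iInf_le _ n))
      refine ⟨c, d, hxcd, hcd.trans hn, ?_⟩
      rw [ENNReal.sub_mul fun _ _ => measure_ne_top _ _, tsub_le_iff_left]
      exact (ENNReal.mul_le_of_le_div hlt.le).trans (hνν' _ (measurableSet_traceIoo _ _))
    rw [hν'E, mul_zero, nonpos_iff_eq_zero, mul_eq_zero] at hmul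
    have hE0 : m E = 0 := hmul.resolve_left (tsub_pos_of_lt hab).ne'
    rw [ae_iff]
    simpa [hE] using hE0
  have hall : ∀ᵐ x ∂m, ∀ r r' : ℚ, r < r' → 0 ≤ r → ¬ (h x < (Real.toNNReal r : ENNReal) ∧
      (Real.toNNReal r' : ENNReal) < ⨅ n : ℕ, maxRatio ν m (1 / ((n : ℝ) + 1)) x) := by
    rw [ae_all_iff]; intro r
    rw [ae_all_iff]; intro r'
    by_cases h1 : r < r'
    · by_cases h2 : 0 ≤ r
      · filter_upwards [key r r' h1 h2] with x hx _ _ using hx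
      · exact .of_forall fun x _ h => absurd h h2
    · exact .of_forall fun x h => absurd h h1
  filter_upwards [hall] with x hx
  by_contra hlt
  obtain ⟨q, hq0, hq1, hq2⟩ := ENNReal.lt_iff_exists_rat_btwn.1 (not_le.1 hlt)
  obtain ⟨q', hq'0, hq'1, hq'2⟩ := ENNReal.lt_iff_exists_rat_btwn.1 hq2
  refine hx q q' ?_ hq0 ⟨hq1, hq'2⟩
  have := ENNReal.coe_lt_coe.1 hq'1
  exact_mod_cast (Real.toNNReal_lt_toNNReal_iff_of_nonneg (by exact_mod_cast hq0)).1 this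

end Differentiation

/-! ### Rigidity of zero entropy -/

lemma norm_log_add_le {t C θ : ℝ} (hθ : 0 < θ) (ht0 : 0 ≤ t) (htC : t ≤ C) :
    ‖Real.log (t + θ)‖ ≤ |Real.log θ| + |Real.log (C + θ)| := by
  have h1 : Real.log θ ≤ Real.log (t + θ) := Real.log_le_log hθ (by linarith)
  have h2 : Real.log (t + θ) ≤ Real.log (C + θ) := Real.log_le_log (by linarith) (by linarith)
  rw [Real.norm_eq_abs, abs_le]
  constructor
  · linarith [neg_abs_le (Real.log θ), abs_nonneg (Real.log (C + θ))]
  · linarith [le_abs_self (Real.log (C + θ)), abs_nonneg (Real.log θ)]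

section Entropy

variable {X : Type*} [MeasurableSpace X]

/-- A measure dominated by a multiple of a finite measure `m` has a bounded real density. -/
lemma exists_bounded_density {m ν : Measure X} [IsFiniteMeasure m] {C : ℝ} (hC0 : 0 ≤ C)
    (h : ν ≤ ENNReal.ofReal C • m) :
    ∃ k : X → ℝ, Measurable k ∧ (∀ x, 0 ≤ k x) ∧ (∀ x, k x ≤ C) ∧
      ν = m.withDensity fun x => ENNReal.ofReal (k x) := by
  have hfin' : IsFiniteMeasure (ENNReal.ofReal C • m) := m.smul_finite ENNReal.ofReal_ne_top
  have hfin : IsFiniteMeasure ν := isFiniteMeasure_of_le (ENNReal.ofReal C • m) h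
  have hac : ν ≪ m := (Measure.absolutelyContinuous_of_le h).trans
    (Measure.smul_absolutelyContinuous)
  have hle : ν.rnDeriv m ≤ᵐ[m] fun _ => ENNReal.ofReal C := by
    refine ae_le_of_forall_setLIntegral_le_of_sigmaFinite (Measure.measurable_rnDeriv _ _)
      fun A hA _ => ?_
    rw [setLIntegral_const]
    exact (Measure.setLIntegral_rnDeriv_le A).trans (h A)
  refine ⟨fun x => min (ν.rnDeriv m x).toReal C,
    (Measure.measurable_rnDeriv ν m).ennreal_toReal.min measurable_const,
    fun x => le_min ENNReal.toReal_nonneg hC0, fun x => min_le_right _ _, ?_⟩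
  conv_lhs => rw [← Measure.withDensity_rnDeriv_eq ν m hac]
  refine withDensity_congr_ae ?_
  filter_upwards [hle] with x hx
  have h1 : ν.rnDeriv m x ≠ ⊤ := ne_top_of_le_ne_top ENNReal.ofReal_ne_top hx
  have h2 : (ν.rnDeriv m x).toReal ≤ C := ENNReal.toReal_le_of_le_ofReal hC0 hx
  rw [min_eq_left h2, ENNReal.ofReal_toReal h1]

lemma integral_withDensity_ofReal {m : Measure X} {k : X → ℝ} (hk : Measurable k)
    (hk0 : ∀ x, 0 ≤ k x) (φ : X → ℝ) :
    ∫ x, φ x ∂(m.withDensity fun x => ENNReal.ofReal (k x)) = ∫ x, k x * φ x ∂m := by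
  rw [integral_withDensity_eq_integral_toReal_smul hk.ennreal_ofReal
    (.of_forall fun x => ENNReal.ofReal_lt_top)]
  simp only [ENNReal.toReal_ofReal (hk0 _), smul_eq_mul]

lemma integrable_withDensity_ofReal_iff {m : Measure X} {k : X → ℝ} (hk : Measurable k)
    (hk0 : ∀ x, 0 ≤ k x) {φ : X → ℝ} :
    Integrable φ (m.withDensity fun x => ENNReal.ofReal (k x)) ↔
      Integrable (fun x => φ x * k x) m := by
  rw [integrable_withDensity_iff hk.ennreal_ofReal (.of_forall fun x => ENNReal.ofReal_lt_top)]
  simp only [ENNReal.toReal_ofReal (hk0 _)]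

variable {ι : Type*} [Fintype ι] [MeasurableSpace ι] [DiscreteMeasurableSpace ι]

lemma map_le_smul_of_stationary {P : Measure ι} {f : ι → X → X} (hf : ∀ s, Measurable (f s))
    {μ : Measure X} [IsFiniteMeasure μ] (hμ : stepLaw P f μ = μ) {s : ι} (hs : P {s} ≠ 0)
    (hs' : P {s} ≠ ⊤) : μ.map (f s) ≤ (P {s})⁻¹ • μ := by
  refine Measure.le_iff.2 fun A hA => ?_
  rw [Measure.map_apply (hf s) hA, Measure.smul_apply, smul_eq_mul]
  conv_rhs => rw [← hμ, stepLaw_apply P hf μ hA]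
  refine (ENNReal.mul_le_iff_le_inv hs hs').1 ?_
  exact Finset.single_le_sum (f := fun s => P {s} * μ (f s ⁻¹' A)) (fun _ _ => zero_le)
    (Finset.mem_univ s)

variable {P : Measure ι} [IsProbabilityMeasure P] {f : ι → X ≃ᵐ X} {m μ : Measure X}
  [IsFiniteMeasure m] [IsProbabilityMeasure μ] {k : X → ℝ} {R : ι → X → ℝ} {C : ℝ}

/-- The key estimate. With `μ = k • m` and `R s` the Jacobian of `f s` with respect to `m`,
concavity of the logarithm bounds the mean of `log (R s + θ)` by a Hellinger affinity, up to the
coboundary `log k - log k ∘ f s`. -/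
lemma integral_log_jacobian_le (hP : ∀ s, P {s} ≠ 0) (hμ : stepLaw P (fun s => f s) μ = μ)
    (hk : Measurable k) (hk0 : ∀ x, 0 ≤ k x) (hk1 : ∀ x, k x ≤ 1)
    (hμk : μ = m.withDensity fun x => ENNReal.ofReal (k x)) (s : ι)
    {r : X → ℝ} (hr : Measurable r) (hr0 : ∀ x, 0 ≤ r x) (hrC : ∀ x, r x ≤ C) {θ : ℝ}
    (hθ : 0 < θ) :
    Integrable (fun x => Real.log (k (f s x))) μ ∧
    ∫ x, Real.log (r x + θ) ∂μ ≤
      2 * (∫ x, √(r x * k (f s x)) * √(k x) ∂m + √θ * m.real Set.univ - 1) -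
        ∫ x, Real.log (k (f s x)) ∂μ + ∫ x, Real.log (k x) ∂μ := by
  have hfm : ∀ s, Measurable (f s) := fun s => (f s).measurable
  have hmap : μ.map (f s) ≤ (P {s})⁻¹ • μ :=
    map_le_smul_of_stationary (f := fun s => f s) hfm hμ (hP s) (measure_ne_top _ _)
  have hinv : (P {s})⁻¹ ≠ ⊤ := ENNReal.inv_ne_top.2 (hP s)
  have hlogk : Integrable (fun x => Real.log (k x)) μ := by
    rw [hμk, integrable_withDensity_ofReal_iff hk hk0]
    refine Integrable.of_bound (C := 1)
      ((hk.log).mul hk).aestronglyMeasurable (.of_forall fun x => ?_)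
    rcases (hk0 x).eq_or_lt with h | h
    · simp [← h]
    · exact (Real.abs_log_mul_self_lt _ h (hk1 x)).le
  have hlogks : Integrable (fun x => Real.log (k (f s x))) μ :=
    ((hlogk.smul_measure hinv).mono_measure hmap).comp_measurable (hfm s)
  have hkpos : ∀ᵐ x ∂μ, 0 < k x := by
    rw [hμk, ae_withDensity_iff hk.ennreal_ofReal]
    refine .of_forall fun x hx => ?_
    by_contra h
    exact hx (ENNReal.ofReal_of_nonpos (not_lt.1 h))
  have hkspos : ∀ᵐ x ∂μ, 0 < k (f s x) := by
    have h1 : ∀ᵐ x ∂(μ.map (f s)), 0 < k x :=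
      ((Measure.absolutelyContinuous_of_le hmap).trans
        Measure.smul_absolutelyContinuous).ae_le hkpos
    exact ae_of_ae_map (hfm s).aemeasurable h1
  refine ⟨hlogks, ?_⟩
  have hks : Measurable fun x => k (f s x) := hk.comp (hfm s)
  -- `w` is the density of the translate of `μ` with respect to `μ`, regularized by `θ`.
  set w : X → ℝ := fun x => (r x + θ) * k (f s x) / k x with hw
  have hC0 : 0 ≤ C := by
    obtain ⟨x⟩ : Nonempty X := nonempty_of_isProbabilityMeasure μ
    exact (hr0 x).trans (hrC x)
  have hwk : ∀ x, √(w x) * k x = √((r x + θ) * k (f s x)) * √(k x) := by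
    intro x
    rcases (hk0 x).eq_or_lt with h | h
    · simp [← h]
    · have hnum : 0 ≤ (r x + θ) * k (f s x) := mul_nonneg (by linarith [hr0 x]) (hk0 _)
      rw [hw, Real.sqrt_div hnum, div_mul_eq_mul_div,
        div_eq_iff (Real.sqrt_pos.2 h).ne', mul_assoc, Real.mul_self_sqrt h.le]
  have hsqrt_le : ∀ {a : ℝ}, a ≤ 1 → √a ≤ 1 := fun h => Real.sqrt_le_one.2 h
  have hint1 : Integrable (fun x => √((r x + θ) * k (f s x)) * √(k x)) m := by
    refine Integrable.of_bound (C := √(C + θ) * 1)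
      (((hr.add_const θ).mul hks).sqrt.mul hk.sqrt).aestronglyMeasurable (.of_forall fun x => ?_)
    rw [Real.norm_of_nonneg (by positivity)]
    refine mul_le_mul (Real.sqrt_le_sqrt ?_) (hsqrt_le (hk1 x)) (by positivity) (by positivity)
    calc (r x + θ) * k (f s x) ≤ (C + θ) * 1 :=
          mul_le_mul (by linarith [hrC x]) (hk1 _) (hk0 _) (by linarith)
      _ = C + θ := mul_one _
  have hint2 : Integrable (fun x => √(r x * k (f s x)) * √(k x)) m := by
    refine hint1.mono ((hr.mul hks).sqrt.mul hk.sqrt).aestronglyMeasurable (.of_forall fun x => ?_)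
    rw [Real.norm_of_nonneg (by positivity), Real.norm_of_nonneg (by positivity)]
    gcongr
    · exact hk0 _
    · linarith
  have hintw : Integrable (fun x => √(w x)) μ := by
    rw [hμk, integrable_withDensity_ofReal_iff hk hk0]
    simpa only [hwk] using hint1
  have hlogr : Integrable (fun x => Real.log (r x + θ)) μ := by
    exact Integrable.of_bound (hr.add_const θ).log.aestronglyMeasurable _
      (.of_forall fun x => norm_log_add_le hθ (hr0 x) (hrC x))
  have hpt : ∀ᵐ x ∂μ, Real.log (r x + θ) ≤
      2 * (√(w x) - 1) - Real.log (k (f s x)) + Real.log (k x) := by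
    filter_upwards [hkpos, hkspos] with x h1 h2
    have h3 : 0 < r x + θ := by linarith [hr0 x]
    have h4 : 0 < w x := div_pos (mul_pos h3 h2) h1
    have h5 : Real.log (w x) = Real.log (r x + θ) + Real.log (k (f s x)) - Real.log (k x) := by
      rw [hw, Real.log_div (mul_pos h3 h2).ne' h1.ne', Real.log_mul h3.ne' h2.ne']
    have h6 := Real.log_le_sub_one_of_pos (Real.sqrt_pos.2 h4)
    rw [Real.log_sqrt h4.le] at h6
    linarith
  have hmono := integral_mono_ae hlogr
    ((((hintw.sub (integrable_const 1)).const_mul 2).sub hlogks).add hlogk) hpt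
  have hcalc : ∫ x, √(w x) ∂μ ≤ ∫ x, √(r x * k (f s x)) * √(k x) ∂m + √θ * m.real Set.univ := by
    rw [hμk, integral_withDensity_ofReal hk hk0]
    have : ∫ x, (√(r x * k (f s x)) * √(k x) + √θ) ∂m =
        ∫ x, √(r x * k (f s x)) * √(k x) ∂m + √θ * m.real Set.univ := by
      rw [integral_add hint2 (integrable_const _), integral_const, smul_eq_mul, mul_comm (m.real _)]
    rw [← this]
    refine integral_mono (by simpa only [mul_comm (k _), hwk] using hint1)
      (hint2.add (integrable_const _)) fun x => ?_
    change k x * √(w x) ≤ √(r x * k (f s x)) * √(k x) + √θ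
    rw [mul_comm, hwk, add_mul]
    have h1 : √(r x * k (f s x) + θ * k (f s x)) ≤ √(r x * k (f s x)) + √(θ * k (f s x)) := by
      have ha := mul_nonneg (hr0 x) (hk0 (f s x))
      have hb := mul_nonneg hθ.le (hk0 (f s x))
      refine Real.sqrt_le_iff.2 ⟨by positivity, ?_⟩
      rw [add_sq, Real.sq_sqrt ha, Real.sq_sqrt hb]
      have := mul_nonneg (Real.sqrt_nonneg (r x * k (f s x))) (Real.sqrt_nonneg (θ * k (f s x)))
      linarith
    have h2 : √(θ * k (f s x)) ≤ √θ :=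
      Real.sqrt_le_sqrt (by nlinarith [hk1 (f s x), hk0 (f s x)])
    have h3 := hsqrt_le (hk1 x)
    have h4 := Real.sqrt_nonneg (k x)
    have h5 := Real.sqrt_nonneg θ
    nlinarith
  have hsplit : ∫ x, (2 * (√(w x) - 1) - Real.log (k (f s x)) + Real.log (k x)) ∂μ =
      2 * (∫ x, √(w x) ∂μ - 1) - ∫ x, Real.log (k (f s x)) ∂μ + ∫ x, Real.log (k x) ∂μ := by
    have hi1 : Integrable (fun x => 2 * (√(w x) - 1)) μ :=
      (hintw.sub (integrable_const 1)).const_mul 2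
    have hi2 : Integrable (fun x => 2 * (√(w x) - 1) - Real.log (k (f s x))) μ := hi1.sub hlogks
    rw [integral_add hi2 hlogk, integral_sub hi1 hlogks, integral_const_mul,
      integral_sub hintw (integrable_const 1)]
    simp
  have hmono' : ∫ x, Real.log (r x + θ) ∂μ ≤ _ := hmono.trans_eq hsplit
  linarith

/-- If the mean logarithmic Jacobian of a stationary measure is nonnegative, then the measure is
invariant: the Hellinger distances between `μ` and its translates average to zero. -/
theorem map_eq_of_integral_log_nonneg (hP : ∀ s, P {s} ≠ 0)
    (hμ : stepLaw P (fun s => f s) μ = μ)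
    (hk : Measurable k) (hk0 : ∀ x, 0 ≤ k x) (hk1 : ∀ x, k x ≤ 1)
    (hμk : μ = m.withDensity fun x => ENNReal.ofReal (k x))
    (hR : ∀ s, Measurable (R s)) (hR0 : ∀ s x, 0 ≤ R s x) (hRC : ∀ s x, R s x ≤ C)
    (hmR : ∀ s, m.map (f s).symm = m.withDensity fun x => ENNReal.ofReal (R s x))
    (hlog : ∀ θ > 0, 0 ≤ ∑ s, P.real {s} * ∫ x, Real.log (R s x + θ) ∂μ) (s : ι) :
    μ.map (f s) = μ := by
  have hPsum : ∑ s, P.real {s} = 1 := by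
    simp
  have hPpos : ∀ s, 0 < P.real {s} := fun s => ENNReal.toReal_pos (hP s) (measure_ne_top _ _)
  set A : ι → ℝ := fun s => ∫ x, √(R s x * k (f s x)) * √(k x) ∂m with hA
  set S : ℝ := ∑ s, P.real {s} * A s with hS
  have hcob : ∑ s, P.real {s} * ∫ x, Real.log (k (f s x)) ∂μ = ∫ x, Real.log (k x) ∂μ := by
    rw [← integral_stepLaw P (f := fun s => f s) (fun s => (f s).measurable) μ hk.log
      (fun s => (integral_log_jacobian_le hP hμ hk hk0 hk1 hμk s (hR s) (hR0 s) (hRC s)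
        one_pos).1), hμ]
  have h1 : ∀ θ > 0, 1 ≤ S + √θ * m.real Set.univ := by
    intro θ hθ
    have hle : ∑ s, P.real {s} * ∫ x, Real.log (R s x + θ) ∂μ ≤
        ∑ s, P.real {s} * (2 * (A s + √θ * m.real Set.univ - 1) -
          ∫ x, Real.log (k (f s x)) ∂μ + ∫ x, Real.log (k x) ∂μ) :=
      Finset.sum_le_sum fun s _ => mul_le_mul_of_nonneg_left
        (integral_log_jacobian_le hP hμ hk hk0 hk1 hμk s (hR s) (hR0 s) (hRC s) hθ).2
        (hPpos s).le
    have hsum : ∑ s, P.real {s} * (2 * (A s + √θ * m.real Set.univ - 1) -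
          ∫ x, Real.log (k (f s x)) ∂μ + ∫ x, Real.log (k x) ∂μ) =
        2 * (S + √θ * m.real Set.univ - 1) := by
      have hterm : ∀ s, P.real {s} * (2 * (A s + √θ * m.real Set.univ - 1) -
          ∫ x, Real.log (k (f s x)) ∂μ + ∫ x, Real.log (k x) ∂μ) =
          2 * (P.real {s} * A s) - P.real {s} * ∫ x, Real.log (k (f s x)) ∂μ +
          P.real {s} * (2 * (√θ * m.real Set.univ - 1) + ∫ x, Real.log (k x) ∂μ) :=
        fun s => by ring
      simp only [hterm]
      rw [Finset.sum_add_distrib, Finset.sum_sub_distrib, ← Finset.mul_sum, ← Finset.sum_mul,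
        hcob, hPsum, ← hS]
      ring
    have := (hlog θ hθ).trans hle
    rw [hsum] at this
    linarith
  have hS1 : 1 ≤ S := by
    have hlim : Filter.Tendsto (fun θ : ℝ => S + √θ * m.real Set.univ) (𝓝[>] 0)
        (𝓝 (S + √0 * m.real Set.univ)) :=
      (Continuous.tendsto (by fun_prop) 0).mono_left nhdsWithin_le_nhds
    have := ge_of_tendsto hlim (eventually_nhdsWithin_of_forall fun θ hθ => h1 θ hθ)
    simpa using this
  have hkint : Integrable k m := Integrable.of_bound (C := 1) hk.aestronglyMeasurable
    (.of_forall fun x => by rw [Real.norm_of_nonneg (hk0 x)]; exact hk1 x)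
  have hkI : ∫ x, k x ∂m = 1 := by
    have := integral_withDensity_ofReal (m := m) hk hk0 (fun _ => 1)
    rw [← hμk] at this
    simpa using this.symm
  have hks : ∀ s, Measurable fun x => k (f s x) := fun s => hk.comp (f s).measurable
  have hRkint : ∀ s, Integrable (fun x => R s x * k (f s x)) m := fun s => by
    refine Integrable.of_bound (C := C) ((hR s).mul (hks s)).aestronglyMeasurable
      (.of_forall fun x => ?_)
    rw [Real.norm_of_nonneg (mul_nonneg (hR0 s x) (hk0 _))]
    exact (mul_le_of_le_one_right (hR0 s x) (hk1 _)).trans (hRC s x)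
  have hRkI : ∀ s, ∫ x, R s x * k (f s x) ∂m = 1 := fun s => by
    rw [← integral_withDensity_ofReal (hR s) (hR0 s), ← hmR s,
      integral_map (f s).symm.measurable.aemeasurable (hks s).aestronglyMeasurable]
    simpa using hkI
  set D : ι → ℝ := fun s => ∫ x, (√(R s x * k (f s x)) - √(k x)) ^ 2 ∂m with hD
  have hsqint : ∀ s, Integrable (fun x => √(R s x * k (f s x)) * √(k x)) m := fun s => by
    refine ((hRkint s).add hkint).mono
      (((hR s).mul (hks s)).sqrt.mul hk.sqrt).aestronglyMeasurable (.of_forall fun x => ?_)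
    have h2 := mul_nonneg (hR0 s x) (hk0 (f s x))
    rw [Real.norm_of_nonneg (by positivity), Pi.add_apply,
      Real.norm_of_nonneg (add_nonneg h2 (hk0 x))]
    nlinarith [sq_nonneg (√(R s x * k (f s x)) - √(k x)), Real.sq_sqrt h2, Real.sq_sqrt (hk0 x)]
  have hexp : ∀ s x, (√(R s x * k (f s x)) - √(k x)) ^ 2 =
      R s x * k (f s x) + k x - 2 * (√(R s x * k (f s x)) * √(k x)) := fun s x => by
    rw [sub_sq, Real.sq_sqrt (mul_nonneg (hR0 s x) (hk0 _)), Real.sq_sqrt (hk0 x)]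
    ring
  have hDA : ∀ s, D s = 2 - 2 * A s := fun s => by
    have hi : Integrable (fun x => R s x * k (f s x) + k x) m := (hRkint s).add hkint
    simp only [hD, hexp]
    rw [integral_sub hi ((hsqint s).const_mul 2),
      integral_add (hRkint s) hkint, hRkI, hkI, integral_const_mul]
    ring
  have hD0 : ∀ s, 0 ≤ D s := fun s => integral_nonneg fun x => sq_nonneg _
  have hDsum : ∑ s, P.real {s} * D s = 2 - 2 * S := by
    simp only [hDA, mul_sub, Finset.sum_sub_distrib, ← Finset.sum_mul, hPsum, hS,
      Finset.mul_sum]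
    congr 1
    · ring
    · exact Finset.sum_congr rfl fun s _ => by ring
  have hDs : D s = 0 := by
    have h2 : P.real {s} * D s ≤ 2 - 2 * S := hDsum ▸ Finset.single_le_sum
      (f := fun s => P.real {s} * D s) (fun s _ => mul_nonneg (hPpos s).le (hD0 s))
      (Finset.mem_univ s)
    nlinarith [hD0 s, hPpos s]
  have hae : ∀ᵐ x ∂m, R s x * k (f s x) = k x := by
    have hi : Integrable (fun x => (√(R s x * k (f s x)) - √(k x)) ^ 2) m := by
      simp only [hexp]
      exact ((hRkint s).add hkint).sub ((hsqint s).const_mul 2)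
    have h2 := (integral_eq_zero_iff_of_nonneg (fun x => sq_nonneg _) hi).1 hDs
    filter_upwards [h2] with x hx
    have h3 : √(R s x * k (f s x)) = √(k x) := sub_eq_zero.1 (pow_eq_zero_iff two_ne_zero |>.1 hx)
    exact (Real.sqrt_inj (mul_nonneg (hR0 s x) (hk0 _)) (hk0 x)).1 h3
  have hsymm : μ.map (f s).symm = μ := by
    ext B hB
    have hpre : MeasurableSet ((f s).symm ⁻¹' B) := (f s).symm.measurable hB
    rw [Measure.map_apply (f s).symm.measurable hB]
    conv_lhs => rw [hμk]
    conv_rhs => rw [hμk]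
    rw [withDensity_apply _ hpre, withDensity_apply _ hB]
    have h2 : ∫⁻ x in (f s).symm ⁻¹' B, ENNReal.ofReal (k x) ∂m =
        ∫⁻ x in B, ENNReal.ofReal (k (f s x)) ∂(m.map (f s).symm) := by
      rw [setLIntegral_map hB (hks s).ennreal_ofReal (f s).symm.measurable]
      simp
    rw [h2, hmR s, setLIntegral_withDensity_eq_setLIntegral_mul _ (hR s).ennreal_ofReal
      (hks s).ennreal_ofReal hB]
    refine setLIntegral_congr_fun_ae hB ?_
    filter_upwards [hae] with x hx _
    rw [Pi.mul_apply, ← ENNReal.ofReal_mul (hR0 s x), hx]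
  conv_lhs => rw [← hsymm]
  rw [Measure.map_map (f s).measurable (f s).symm.measurable]
  simp

end Entropy

/-! ### Reference measures -/

/-- A finite measure on a compact `K ⊆ ℝ` for which an interval with endpoints in `K` has mass at
least its length: the image of Lebesgue measure under the map sending `t` to the next point of `K`
on its right, so that each gap of `K` becomes an atom. -/
theorem exists_measure_uIcc_ge_dist {K : Set ℝ} (hK : IsCompact K) :
    ∃ ℓ : Measure K, IsFiniteMeasure ℓ ∧
      ∀ x y : K, ENNReal.ofReal (dist x y) ≤ ℓ (Set.uIcc x y) := by
  rcases K.eq_empty_or_nonempty with rfl | hne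
  · exact ⟨0, inferInstance, fun x => x.2.elim⟩
  obtain ⟨a, haK, ha⟩ := hK.exists_isLeast hne
  obtain ⟨b, hbK, hb⟩ := hK.exists_isGreatest hne
  have hnext : ∀ t : ℝ, ∃ z, IsLeast (K ∩ Set.Ici (min t b)) z := fun t =>
    (hK.inter_right isClosed_Ici).exists_isLeast ⟨b, hbK, Set.mem_Ici.2 (min_le_right _ _)⟩
  choose π hπ using hnext
  have hmono : Monotone π := fun t t' h =>
    (hπ t).2 ⟨(hπ t').1.1, (min_le_min_right b h).trans (hπ t').1.2⟩
  let Φ : ℝ → K := fun t => ⟨π t, (hπ t).1.1⟩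
  have hΦ : Measurable Φ := hmono.measurable.subtype_mk
  refine ⟨(volume.restrict (Set.Icc a b)).map Φ, inferInstance, fun x y => ?_⟩
  wlog hxy : x ≤ y generalizing x y
  · rw [dist_comm, Set.uIcc_comm]
    exact this y x (le_of_not_ge hxy)
  have hxy' : (x : ℝ) ≤ y := hxy
  rw [Set.uIcc_of_le hxy, Measure.map_apply hΦ measurableSet_Icc,
    Measure.restrict_apply (hΦ measurableSet_Icc)]
  calc ENNReal.ofReal (dist x y) = volume (Set.Ioc (x : ℝ) y) := by
        rw [Real.volume_Ioc, dist_comm, Subtype.dist_eq, Real.dist_eq,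
          abs_of_nonneg (sub_nonneg.2 hxy')]
    _ ≤ _ := by
        refine measure_mono fun t ht => ⟨⟨?_, ?_⟩, ?_, ?_⟩
        · have h1 : min t b ≤ π t := (hπ t).1.2
          rw [min_eq_left (ht.2.trans (hb y.2))] at h1
          exact (ht.1.le.trans h1 : (x : ℝ) ≤ π t)
        · exact ((hπ t).2 ⟨y.2, (min_le_left _ _).trans ht.2⟩ : π t ≤ (y : ℝ))
        · exact (ha x.2).trans ht.1.le
        · exact ht.2.trans (hb y.2)

/-- Every finite measure `ν` is dominated by a finite measure `m` whose images under a given finite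
family of transformations are dominated by multiples of `m`: sum the images of `ν` under all words
in the family with geometrically decreasing weights. -/
theorem exists_measure_ge_map_le_smul {ι X : Type*} [Fintype ι] [Nonempty ι] [MeasurableSpace X]
    (f : ι → X → X) (hf : ∀ s, Measurable (f s)) (ν : Measure X) [IsFiniteMeasure ν] :
    ∃ m : Measure X, IsFiniteMeasure m ∧ ν ≤ m ∧
      ∃ C : ℝ, 0 ≤ C ∧ ∀ s, m.map (f s) ≤ ENNReal.ofReal C • m := by
  set N : ENNReal := (Fintype.card ι : ENNReal) with hN
  have hN0 : N ≠ 0 := by simp [hN]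
  have hNtop : N ≠ ⊤ := by simp [hN]
  set c : ENNReal := (2 * N)⁻¹ with hc
  have hc1 : 2 * N * c = 1 := ENNReal.mul_inv_cancel (by simp [hN0]) (by finiteness)
  set ρ : ℕ → Measure X := fun n => (fun κ => ∑ s, Measure.map (f s) κ)^[n] ν with hρ
  have hρ_succ : ∀ n A, MeasurableSet A → ρ (n + 1) A = ∑ s, ρ n (f s ⁻¹' A) := by
    intro n A hA
    simp only [hρ, Function.iterate_succ_apply', Measure.coe_finsetSum, Finset.sum_apply]
    exact Finset.sum_congr rfl fun s _ => Measure.map_apply (hf s) hA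
  have hmass : ∀ n, ρ n Set.univ = N ^ n * ν Set.univ := by
    intro n
    induction n with
    | zero => simp [hρ]
    | succ n ih =>
      rw [hρ_succ n _ .univ]
      simp only [Set.preimage_univ, ih, Finset.sum_const, Finset.card_univ, nsmul_eq_mul]
      rw [← hN, pow_succ]
      ring
  set m : Measure X := Measure.sum fun n => c ^ n • ρ n with hm
  have hm_apply : ∀ A, MeasurableSet A → m A = ∑' n, c ^ n * ρ n A := fun A hA => by
    simp [hm, Measure.sum_apply _ hA]
  have hcN : c * N = 2⁻¹ := by
    rw [hc, ENNReal.mul_inv (by simp) (by simp), mul_assoc, ENNReal.inv_mul_cancel hN0 hNtop,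
      mul_one]
  refine ⟨m, ⟨?_⟩, Measure.le_iff.2 fun A hA => ?_, (2 * N).toReal, ENNReal.toReal_nonneg,
    fun s => Measure.le_iff.2 fun A hA => ?_⟩
  · rw [hm_apply _ .univ]
    have h1 : ∀ n, c ^ n * ρ n Set.univ = 2⁻¹ ^ n * ν Set.univ := fun n => by
      rw [hmass, ← mul_assoc, ← mul_pow, hcN]
    simp only [h1]
    rw [ENNReal.tsum_mul_right, ENNReal.tsum_geometric]
    refine ENNReal.mul_lt_top ?_ (measure_lt_top _ _)
    rw [ENNReal.one_sub_inv_two, inv_inv]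
    exact ENNReal.ofNat_lt_top
  · rw [hm_apply A hA]
    refine le_trans ?_ (ENNReal.le_tsum 0)
    simp [hρ]
  · rw [Measure.map_apply (hf s) hA, hm_apply _ (hf s hA), Measure.smul_apply, smul_eq_mul,
      ENNReal.ofReal_toReal (by finiteness), hm_apply A hA]
    calc ∑' n, c ^ n * ρ n (f s ⁻¹' A) ≤ ∑' n, 2 * N * (c ^ (n + 1) * ρ (n + 1) A) := by
          refine ENNReal.tsum_le_tsum fun n => ?_
          have h1 : 2 * N * (c ^ (n + 1) * ρ (n + 1) A) = c ^ n * ρ (n + 1) A := by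
            rw [pow_succ, ← mul_assoc, mul_comm (c ^ n), ← mul_assoc, hc1, one_mul]
          rw [h1, hρ_succ n A hA]
          gcongr
          exact Finset.single_le_sum (f := fun s => ρ n (f s ⁻¹' A)) (fun _ _ => zero_le)
            (Finset.mem_univ s)
      _ = 2 * N * ∑' n, c ^ (n + 1) * ρ (n + 1) A := ENNReal.tsum_mul_left
      _ ≤ _ := by
          refine mul_le_mul' le_rfl ?_
          exact ENNReal.tsum_comp_le_tsum_of_injective Nat.succ_injective fun n => c ^ n * ρ n A

/-! ### Locally monotonic homeomorphisms -/

section LocalOrder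

variable {K : Set ℝ}

lemma exists_image_uIcc_subset [CompactSpace K] {f : K → K}
    (hf : LocallyMonotonic fun x => (f x : ℝ)) :
    ∃ δ > 0, ∀ x y : K, dist x y < δ → f '' Set.uIcc x y ⊆ Set.uIcc (f x) (f y) := by
  choose U hU hmon using hf
  obtain ⟨δ, hδ, hball⟩ := lebesgue_number_lemma_of_metric (s := (Set.univ : Set K))
    (c := fun x => interior (U x)) isCompact_univ (fun x => isOpen_interior)
    (fun x _ => Set.mem_iUnion.2 ⟨x, mem_interior_iff_mem_nhds.2 (hU x)⟩)
  refine ⟨δ, hδ, fun x y hxy => ?_⟩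
  obtain ⟨i, hi⟩ := hball x trivial
  have hsub : Set.uIcc x y ⊆ U i := by
    intro z hz
    refine interior_subset (hi ?_)
    rw [Metric.mem_ball, Subtype.dist_eq]
    rw [Subtype.dist_eq, Real.dist_eq] at hxy
    rw [Real.dist_eq]
    refine lt_of_le_of_lt ?_ hxy
    have hz' : (z : ℝ) ∈ Set.uIcc (x : ℝ) y := by
      rcases le_total x y with h | h
      · rw [Set.uIcc_of_le h] at hz
        rw [Set.uIcc_of_le (show (x : ℝ) ≤ y from h)]
        exact hz
      · rw [Set.uIcc_of_ge h] at hz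
        rw [Set.uIcc_of_ge (show (y : ℝ) ≤ x from h)]
        exact hz
    rw [abs_sub_comm x.1]
    exact Set.abs_sub_left_of_mem_uIcc hz'
  rcases hmon i with h | h
  · have h' : MonotoneOn f (Set.uIcc x y) := fun a ha b hb hab => h (hsub ha) (hsub hb) hab
    exact h'.image_uIcc_subset
  · have h' : AntitoneOn f (Set.uIcc x y) := fun a ha b hb hab => h (hsub ha) (hsub hb) hab
    exact h'.image_uIcc_subset

/-- A homeomorphism which is locally monotonic together with its inverse maps short intervals
onto intervals. -/
lemma exists_image_uIcc_eq [CompactSpace K] (f : K ≃ₜ K)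
    (hf : LocallyMonotonic fun x => (f x : ℝ)) (hf' : LocallyMonotonic fun x => (f.symm x : ℝ)) :
    ∃ δ > 0, ∀ x y : K, dist x y < δ → f '' Set.uIcc x y = Set.uIcc (f x) (f y) := by
  obtain ⟨δ₁, h1, hf1⟩ := exists_image_uIcc_subset hf
  obtain ⟨δ₂, h2, hf2⟩ := exists_image_uIcc_subset hf'
  obtain ⟨δ₃, h3, hf3⟩ := Metric.uniformContinuous_iff.1
    (CompactSpace.uniformContinuous_of_continuous f.continuous) δ₂ h2
  refine ⟨min δ₁ δ₃, lt_min h1 h3, fun x y hxy => ?_⟩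
  refine subset_antisymm (hf1 x y (hxy.trans_le (min_le_left _ _))) fun z hz => ?_
  have hsub := hf2 (f x) (f y) (hf3 (hxy.trans_le (min_le_right _ _)))
  rw [f.symm_apply_apply, f.symm_apply_apply] at hsub
  exact ⟨f.symm z, hsub ⟨z, hz, rfl⟩, f.apply_symm_apply z⟩

end LocalOrder

/-! ### Exponential contraction along typical trajectories -/

section Contraction

variable {K : Set ℝ} {S : Set (K ≃ₜ K)}

lemma randomComp_consSeq (s : S) (ω : ℕ → S) (n : ℕ) :
    randomComp (consSeq s ω) (n + 1) = randomComp ω n ∘ (s : K ≃ₜ K) := by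
  induction n with
  | zero => rfl
  | succ n ih =>
    change ((consSeq s ω (n + 1) : S) : K ≃ₜ K) ∘ randomComp (consSeq s ω) (n + 1) = _
    rw [ih]
    rfl

lemma continuous_randomComp (ω : ℕ → S) (n : ℕ) : Continuous (randomComp ω n) := by
  induction n with
  | zero => exact continuous_id
  | succ n ih => exact (ω n : K ≃ₜ K).continuous.comp ih

/-- The point `x` has a neighborhood which is contracted at exponential rate `l` along `ω`. -/
def IsContracted (l : ℝ) (ω : ℕ → S) (x : K) : Prop :=
  ∃ B ∈ 𝓝 x, ∃ C : ℝ, ∀ n : ℕ, Metric.diam (randomComp ω n '' B) ≤ C * Real.exp (-(n * l))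

/-- If the measure of the interval between two orbits is multiplied at each step by at most
`exp (a n)` as long as the orbits are `ε`-close, and the sums of the `a n` decrease linearly, then
a neighborhood of the starting point is contracted exponentially. -/
lemma isContracted_of_sum_le [CompactSpace K] {m : Measure K} [IsFiniteMeasure m]
    (hm : ∀ x y : K, dist x y ≤ m.real (Set.uIcc x y)) {ω : ℕ → S} {x : K} {ε l : ℝ}
    (hε : 0 < ε) (hl : 0 < l) {a : ℕ → ℝ}
    (hstep : ∀ n y, dist (randomComp ω n x) y < ε →
      m.real (Set.uIcc (randomComp ω (n + 1) x) ((ω n : K ≃ₜ K) y)) ≤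
        Real.exp (a n) * m.real (Set.uIcc (randomComp ω n x) y))
    (hsum : ∀ n, ∑ k ∈ Finset.range n, (a k + l) ≤ 0) :
    IsContracted l ω x := by
  set V := m.real Set.univ with hV
  have hlim : Filter.Tendsto (fun n : ℕ => V * Real.exp (-(n * l))) Filter.atTop (𝓝 0) := by
    have h1 : Filter.Tendsto (fun n : ℕ => (n : ℝ) * l) Filter.atTop Filter.atTop :=
      tendsto_natCast_atTop_atTop.atTop_mul_const hl
    simpa using (Real.tendsto_exp_neg_atTop_nhds_zero.comp h1).const_mul V
  obtain ⟨n₀, hn₀⟩ := Filter.eventually_atTop.1 (hlim.eventually_lt_const hε)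
  -- Up to time `n₀` closeness comes from continuity, afterwards from the contraction itself.
  set B : Set K := ⋂ k ∈ Finset.range n₀, {y | dist (randomComp ω k x) (randomComp ω k y) < ε}
  have hB : B ∈ 𝓝 x := by
    refine (Filter.biInter_finset_mem _).2 fun k _ => IsOpen.mem_nhds ?_ (by simpa using hε)
    exact isOpen_lt (continuous_const.dist (continuous_randomComp ω k)) continuous_const
  have hbound : ∀ y n, (∀ k < n, dist (randomComp ω k x) (randomComp ω k y) < ε) →
      m.real (Set.uIcc (randomComp ω n x) (randomComp ω n y)) ≤
        V * Real.exp (∑ k ∈ Finset.range n, a k) := by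
    intro y n
    induction n with
    | zero =>
      intro _
      simpa using measureReal_mono (Set.subset_univ _)
    | succ n ih =>
      intro h
      have h1 := ih fun k hk => h k (hk.trans n.lt_succ_self)
      have h2 := hstep n (randomComp ω n y) (h n n.lt_succ_self)
      rw [Finset.sum_range_succ, Real.exp_add]
      calc m.real (Set.uIcc (randomComp ω (n + 1) x) (randomComp ω (n + 1) y))
          ≤ Real.exp (a n) * m.real (Set.uIcc (randomComp ω n x) (randomComp ω n y)) := h2
        _ ≤ Real.exp (a n) * (V * Real.exp (∑ k ∈ Finset.range n, a k)) := by gcongr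
        _ = _ := by ring
  have hexp : ∀ n : ℕ, V * Real.exp (∑ k ∈ Finset.range n, a k) ≤ V * Real.exp (-(n * l)) := by
    intro n
    have h1 := hsum n
    rw [Finset.sum_add_distrib, Finset.sum_const, Finset.card_range, nsmul_eq_mul] at h1
    gcongr
    linarith
  have hclose : ∀ y ∈ B, ∀ n, dist (randomComp ω n x) (randomComp ω n y) < ε := by
    intro y hy n
    induction n using Nat.strong_induction_on with
    | _ n ih =>
      rcases lt_or_ge n n₀ with h | h
      · exact Set.mem_iInter₂.1 hy n (Finset.mem_range.2 h)
      · exact (((hm _ _).trans (hbound y n ih)).trans (hexp n)).trans_lt (hn₀ n h)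
  have hdist : ∀ y ∈ B, ∀ n, dist (randomComp ω n x) (randomComp ω n y) ≤
      V * Real.exp (-(n * l)) := fun y hy n =>
    ((hm _ _).trans (hbound y n fun k _ => hclose y hy k)).trans (hexp n)
  refine ⟨B, hB, 2 * V, fun n => Metric.diam_le_of_forall_dist_le (by positivity) ?_⟩
  rintro _ ⟨y, hy, rfl⟩ _ ⟨z, hz, rfl⟩
  have h1 := dist_triangle_left (randomComp ω n y) (randomComp ω n z) (randomComp ω n x)
  linarith [hdist y hy n, hdist z hz n]

/-- The skew product `(x, ω) ↦ (ω 0 x, shift ω)` associated with the random walk. -/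
def skewProduct (q : K × (ℕ → S)) : K × (ℕ → S) := ((q.2 0 : K ≃ₜ K) q.1, fun n => q.2 (n + 1))

lemma skewProduct_iterate (q : K × (ℕ → S)) (n : ℕ) :
    skewProduct^[n] q = (randomComp q.2 n q.1, fun i => q.2 (i + n)) := by
  induction n with
  | zero => rfl
  | succ n ih =>
    rw [Function.iterate_succ_apply', ih]
    simp only [skewProduct, zero_add, Prod.mk.injEq]
    refine ⟨rfl, funext fun i => ?_⟩
    rw [add_right_comm, add_assoc]

lemma measurePreserving_head [MeasurableSpace S] (P : Measure S)
    [IsProbabilityMeasure P] (μ : Measure K) [IsProbabilityMeasure μ] :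
    MeasurePreserving (fun q : K × (ℕ → S) => (q.2 0, q.1))
      (μ.prod (Measure.infinitePi fun _ : ℕ => P)) (P.prod μ) :=
  Measure.measurePreserving_swap.comp
    ((MeasurePreserving.id μ).prod (measurePreserving_eval_infinitePi (fun _ : ℕ => P) 0))

variable [Fintype S] [MeasurableSpace S] [DiscreteMeasurableSpace S] (P : Measure S)
  [IsProbabilityMeasure P]

lemma measurable_action : Measurable fun q : S × K => (q.1 : K ≃ₜ K) q.2 :=
  measurable_uncurry_of_discrete (f := fun (s : S) => ((s : K ≃ₜ K) : K → K))
    fun s => (s : K ≃ₜ K).measurable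

lemma measurable_skewProduct : Measurable (skewProduct (K := K) (S := S)) := by
  refine Measurable.prodMk ?_ ?_
  · have h : Measurable fun q : K × (ℕ → S) => (q.2 0, q.1) :=
      ((measurable_pi_apply 0).comp measurable_snd).prodMk measurable_fst
    exact measurable_action.comp h
  · exact measurable_pi_lambda _ fun n => (measurable_pi_apply (n + 1)).comp measurable_snd

/-- A stationary measure gives rise to an invariant measure of the skew product. -/
lemma measurePreserving_skewProduct {μ : Measure K} [IsProbabilityMeasure μ]
    (hμ : stepLaw P (fun s : S => ((s : K ≃ₜ K) : K → K)) μ = μ) :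
    MeasurePreserving (skewProduct (K := K) (S := S))
      (μ.prod (Measure.infinitePi fun _ : ℕ => P))
      (μ.prod (Measure.infinitePi fun _ : ℕ => P)) := by
  set Q := Measure.infinitePi fun _ : ℕ => P
  have h1 : MeasurePreserving (Prod.map id fun q : S × (ℕ → S) => consSeq q.1 q.2)
      (μ.prod (P.prod Q)) (μ.prod Q) := (MeasurePreserving.id μ).prod (measurePreserving_consSeq P)
  have h2 : MeasurePreserving (fun q : K × S => (q.2 : K ≃ₜ K) q.1) (μ.prod P) μ :=
    (⟨measurable_action, hμ⟩ : MeasurePreserving (fun q : S × K => (q.1 : K ≃ₜ K) q.2)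
      (P.prod μ) μ).comp Measure.measurePreserving_swap
  have h3 : MeasurePreserving (Prod.map (fun q : K × S => (q.2 : K ≃ₜ K) q.1) id ∘
      (MeasurableEquiv.prodAssoc (α := K) (β := S) (γ := ℕ → S)).symm)
      (μ.prod (P.prod Q)) (μ.prod Q) :=
    (h2.prod (MeasurePreserving.id Q)).comp (measurePreserving_prodAssoc μ P Q).symm
  refine ⟨measurable_skewProduct, ?_⟩
  conv_lhs => rw [← h1.map_eq]
  rw [Measure.map_map measurable_skewProduct h1.measurable]
  exact h3.map_eq

end Contraction

section PositiveContraction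

variable {K : Set ℝ} {S : Set (K ≃ₜ K)}

/-- As the scale tends to `0`, the exponent at that scale tends to at most the mean logarithmic
Jacobian; the regularization `θ` and the bound `C` provide the domination. -/
lemma integral_log_maxRatio_tendsto_le {m μ : Measure K} [CompactSpace K] [IsFiniteMeasure m]
    [IsProbabilityMeasure μ] (hμm : μ ≪ m) {r : K → ℝ} (hr : Measurable r) (hr0 : ∀ x, 0 ≤ r x)
    {C : ℝ} (hrC : ∀ x, r x ≤ C) {θ : ℝ} (hθ : 0 < θ) :
    ∃ L : ℝ, L ≤ ∫ x, Real.log (r x + θ) ∂μ ∧ Filter.Tendsto (fun n : ℕ => ∫ x, Real.log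
      ((maxRatio (m.withDensity fun x => ENNReal.ofReal (r x)) m (1 / ((n : ℝ) + 1)) x).toReal + θ)
      ∂μ) Filter.atTop (𝓝 L) := by
  have hC0 : 0 ≤ C := by
    obtain ⟨x⟩ : Nonempty K := nonempty_of_isProbabilityMeasure μ
    exact (hr0 x).trans (hrC x)
  set ν := m.withDensity fun x => ENNReal.ofReal (r x) with hν
  have hνC : ν ≤ ENNReal.ofReal C • m := by
    rw [hν, ← withDensity_const]
    exact withDensity_mono (.of_forall fun x => ENNReal.ofReal_le_ofReal (hrC x))
  have hfin' : IsFiniteMeasure (ENNReal.ofReal C • m) := m.smul_finite ENNReal.ofReal_ne_top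
  have hfin : IsFiniteMeasure ν := isFiniteMeasure_of_le (ENNReal.ofReal C • m) hνC
  set M : ℕ → K → ENNReal := fun n => maxRatio ν m (1 / ((n : ℝ) + 1)) with hM
  have hMC : ∀ n x, M n x ≤ ENNReal.ofReal C := fun n x => maxRatio_le hνC _ x
  have hMm : ∀ n, Measurable (M n) := fun n => measurable_maxRatio _ _ _
  have hMr : ∀ n x, (M n x).toReal ≤ C := fun n x =>
    ENNReal.toReal_le_of_le_ofReal hC0 (hMC n x)
  have hIC : ∀ x, ⨅ n, M n x ≤ ENNReal.ofReal C := fun x => (iInf_le _ 0).trans (hMC 0 x)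
  have hIm : Measurable fun x => ⨅ n, M n x := Measurable.iInf hMm
  refine ⟨∫ x, Real.log ((⨅ n, M n x).toReal + θ) ∂μ, ?_, ?_⟩
  · refine integral_mono_ae ?_ ?_ ?_
    · exact Integrable.of_bound ((hIm.ennreal_toReal.add_const θ).log).aestronglyMeasurable _
        (.of_forall fun x => norm_log_add_le hθ ENNReal.toReal_nonneg
          (ENNReal.toReal_le_of_le_ofReal hC0 (hIC x)))
    · exact Integrable.of_bound ((hr.add_const θ).log).aestronglyMeasurable _
        (.of_forall fun x => norm_log_add_le hθ (hr0 x) (hrC x))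
    · filter_upwards [hμm.ae_le (ae_iInf_maxRatio_le (m := m) hr.ennreal_ofReal)] with x hx
      refine Real.log_le_log (add_pos_of_nonneg_of_pos ENNReal.toReal_nonneg hθ) ?_
      have := ENNReal.toReal_le_of_le_ofReal (hr0 x) hx
      linarith
  · refine tendsto_integral_of_dominated_convergence
      (fun _ => |Real.log θ| + |Real.log (C + θ)|)
      (fun n => (((hMm n).ennreal_toReal.add_const θ).log).aestronglyMeasurable)
      (integrable_const _)
      (fun n => .of_forall fun x => norm_log_add_le hθ ENNReal.toReal_nonneg (hMr n x))
      (.of_forall fun x => ?_)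
    have hanti : Antitone fun n => M n x := fun i j hij =>
      maxRatio_mono _ _ (Nat.one_div_le_one_div hij) x
    have h1 : Filter.Tendsto (fun n => (M n x).toReal) Filter.atTop (𝓝 (⨅ n, M n x).toReal) :=
      (ENNReal.tendsto_toReal (ne_top_of_le_ne_top ENNReal.ofReal_ne_top (hIC x))).comp
        (tendsto_atTop_iInf hanti)
    refine Filter.Tendsto.log (h1.add_const θ) ?_
    exact (add_pos_of_nonneg_of_pos ENNReal.toReal_nonneg hθ).ne'

variable [Fintype S] [MeasurableSpace S] [DiscreteMeasurableSpace S] (P : Measure S)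
  [IsProbabilityMeasure P]

/-- A negative Lyapunov exponent at scale `ε` forces contraction with positive probability, by the
maximal ergodic theorem for the skew product. -/
lemma exists_measure_isContracted_pos_of_exponent_neg [CompactSpace K] {m μ : Measure K}
    [IsFiniteMeasure m] [IsProbabilityMeasure μ]
    (hμ : stepLaw P (fun s : S => ((s : K ≃ₜ K) : K → K)) μ = μ)
    (hdist : ∀ x y : K, dist x y ≤ m.real (Set.uIcc x y)) {C : ℝ} (hC0 : 0 ≤ C)
    (hC : ∀ s : S, m.map (s : K ≃ₜ K).symm ≤ ENNReal.ofReal C • m)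
    {ε : ℝ} (hε0 : 0 < ε)
    (himg : ∀ (s : S) (x y : K), dist x y < ε →
      (s : K ≃ₜ K) '' Set.uIcc x y = Set.uIcc ((s : K ≃ₜ K) x) ((s : K ≃ₜ K) y))
    {θ : ℝ} (hθ : 0 < θ)
    (hneg : ∑ s : S, P.real {s} *
      ∫ x, Real.log ((maxRatio (m.map (s : K ≃ₜ K).symm) m ε x).toReal + θ) ∂μ < 0) :
    ∃ l > 0, (μ.prod (Measure.infinitePi fun _ : ℕ => P))
      {q | IsContracted l q.2 q.1} ≠ 0 := by
  obtain ⟨M, hMdef⟩ : ∃ M : S → K → ENNReal,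
      ∀ s, M s = maxRatio (m.map (s : K ≃ₜ K).symm) m ε := ⟨_, fun _ => rfl⟩
  simp only [← hMdef] at hneg
  have hMm : ∀ s, Measurable (M s) := fun s => hMdef s ▸ measurable_maxRatio _ _ _
  have hMC : ∀ s x, M s x ≤ ENNReal.ofReal C := fun s x => hMdef s ▸ maxRatio_le (hC s) ε x
  have hMr : ∀ s x, (M s x).toReal ≤ C := fun s x => ENNReal.toReal_le_of_le_ofReal hC0 (hMC s x)
  set φ : S × K → ℝ := fun q => Real.log ((M q.1 q.2).toReal + θ) with hφ
  have hφm : Measurable φ := measurable_from_prod_countable_right fun s =>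
    ((hMm s).ennreal_toReal.add_const θ).log
  have hφpos : ∀ s x, 0 < (M s x).toReal + θ := fun s x =>
    add_pos_of_nonneg_of_pos ENNReal.toReal_nonneg hθ
  have hφbd : ∀ q, ‖φ q‖ ≤ |Real.log θ| + |Real.log (C + θ)| := fun q =>
    norm_log_add_le hθ ENNReal.toReal_nonneg (hMr q.1 q.2)
  have hφi : Integrable φ (P.prod μ) :=
    Integrable.of_bound hφm.aestronglyMeasurable _ (.of_forall hφbd)
  set D : ℝ := ∑ s, P.real {s} * ∫ x, Real.log ((M s x).toReal + θ) ∂μ with hD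
  have hφint : ∫ q, φ q ∂(P.prod μ) = D := by
    rw [integral_prod _ hφi, integral_fintype (.of_finite)]
    simp [hD, hφ]
  set l : ℝ := -D / 2 with hl
  have hl0 : 0 < l := by
    have : D < 0 := hneg
    linarith
  refine ⟨l, hl0, ?_⟩
  set Q := Measure.infinitePi fun _ : ℕ => P with hQ
  set g : K × (ℕ → S) → ℝ := fun q => φ (q.2 0, q.1) + l with hg
  have hhead := measurePreserving_head P μ
  have hφi' : Integrable (fun q : K × (ℕ → S) => φ (q.2 0, q.1)) (μ.prod Q) :=
    hhead.integrable_comp_of_integrable hφi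
  have hgneg : ∫ q, g q ∂(μ.prod Q) < 0 := by
    have h1 : ∫ q : K × (ℕ → S), φ (q.2 0, q.1) ∂(μ.prod Q) = D := by
      rw [← hφint, ← hhead.map_eq, integral_map hhead.measurable.aemeasurable
        hφm.aestronglyMeasurable]
    rw [hg, integral_add hφi' (integrable_const l), h1]
    simp only [integral_const, probReal_univ, smul_eq_mul, one_mul]
    linarith
  have hpos := measure_forall_birkhoffSum_nonpos_pos (measurePreserving_skewProduct P hμ)
    ((hφm.comp hhead.measurable).add_const l) (hφi'.add (integrable_const l)) hgneg
  suffices hsub : {q | ∀ n, birkhoffSum skewProduct g n q ≤ 0} ⊆ {q | IsContracted l q.2 q.1} from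
    fun h => hpos.ne' (measure_mono_null hsub h)
  rintro ⟨x, ω⟩ hx
  change IsContracted l ω x
  refine isContracted_of_sum_le hdist hε0 hl0 (a := fun i => φ (ω i, randomComp ω i x)) ?_ ?_
  · intro i y hy
    set z := randomComp ω i x with hz
    have h2 : m.map (ω i : K ≃ₜ K).symm (Set.uIcc z y) =
        m (Set.uIcc (randomComp ω (i + 1) x) ((ω i : K ≃ₜ K) y)) := by
      rw [Measure.map_apply (ω i : K ≃ₜ K).symm.measurable measurableSet_uIcc]
      change _ = m (Set.uIcc ((ω i : K ≃ₜ K) z) _)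
      rw [← himg _ z y hy, Homeomorph.image_eq_preimage_symm]
    have h3 := measure_uIcc_le_maxRatio_mul ENNReal.ofReal_ne_top (hC (ω i)) hy
    rw [h2, ← hMdef] at h3
    have hMtop : M (ω i) z ≠ ⊤ := ne_top_of_le_ne_top ENNReal.ofReal_ne_top (hMC (ω i) z)
    have h4 := ENNReal.toReal_mono (ENNReal.mul_ne_top hMtop (measure_ne_top _ _)) h3
    rw [ENNReal.toReal_mul] at h4
    refine h4.trans ?_
    change (M (ω i) z).toReal * m.real _ ≤ Real.exp (φ (ω i, z)) * m.real _
    rw [hφ, Real.exp_log (hφpos _ _)]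
    gcongr
    linarith
  · intro i
    have h1 := hx i
    simp only [birkhoffSum, skewProduct_iterate] at h1
    simpa [hg] using h1

/-- If `μ` is stationary but not invariant, then contraction at some exponential rate happens with
positive probability, for a starting point chosen according to `μ`. Its Lyapunov exponent, measured
with a reference measure `m` that dominates `μ` and lengths and is quasi-invariant with bounded
Jacobians, is negative by `map_eq_of_integral_log_nonneg`. -/
theorem exists_measure_isContracted_pos [CompactSpace K] (hP : ∀ s, P {s} ≠ 0)
    (hmono : ∀ s : S, LocallyMonotonic (fun x => ((s : K ≃ₜ K) x : ℝ)) ∧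
      LocallyMonotonic (fun x => ((s : K ≃ₜ K).symm x : ℝ)))
    {μ : Measure K} [IsProbabilityMeasure μ]
    (hμ : stepLaw P (fun s : S => ((s : K ≃ₜ K) : K → K)) μ = μ)
    (hninv : ¬ ∀ s : S, μ.map (s : K ≃ₜ K) = μ) :
    ∃ l > 0, (μ.prod (Measure.infinitePi fun _ : ℕ => P))
      {q | IsContracted l q.2 q.1} ≠ 0 := by
  have hSne : Nonempty S := nonempty_of_isProbabilityMeasure P
  set f : S → K ≃ᵐ K := fun s => (s : K ≃ₜ K).toMeasurableEquiv with hf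
  obtain ⟨ℓ, hℓfin, hℓ⟩ := exists_measure_uIcc_ge_dist (isCompact_iff_compactSpace.2 ‹_›)
  obtain ⟨m, hmfin, hνm, C, hC0, hC⟩ := exists_measure_ge_map_le_smul
    (fun s => (f s).symm) (fun s => (f s).symm.measurable) (μ + ℓ)
  have hμm : μ ≤ ENNReal.ofReal 1 • m := by
    simpa using (Measure.le_add_right le_rfl).trans hνm
  have hdist : ∀ x y : K, dist x y ≤ m.real (Set.uIcc x y) := fun x y =>
    (ENNReal.ofReal_le_iff_le_toReal (measure_ne_top _ _)).1
      ((hℓ x y).trans (((Measure.le_add_left le_rfl).trans hνm) _))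
  obtain ⟨k, hk, hk0, hk1, hμk⟩ := exists_bounded_density zero_le_one hμm
  choose R hR hR0 hRC hmR using fun s => exists_bounded_density hC0 (hC s)
  -- A regularization parameter for which the exponent is negative.
  obtain ⟨θ, hθ, hneg⟩ : ∃ θ > 0, ∑ s, P.real {s} * ∫ x, Real.log (R s x + θ) ∂μ < 0 := by
    by_contra! h
    exact hninv fun s => map_eq_of_integral_log_nonneg (f := f) hP hμ hk hk0 hk1 hμk hR hR0 hRC
      hmR h s
  have hμac : μ ≪ m := hμk ▸ withDensity_absolutelyContinuous _ _
  choose L hL hLlim using fun s =>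
    integral_log_maxRatio_tendsto_le hμac (hR s) (hR0 s) (hRC s) hθ
  have hlim := tendsto_finsetSum (Finset.univ : Finset S)
    fun s _ => (hLlim s).const_mul (P.real {s})
  have hLneg : ∑ s, P.real {s} * L s < 0 := lt_of_le_of_lt
    (Finset.sum_le_sum fun s _ => mul_le_mul_of_nonneg_left (hL s) measureReal_nonneg) hneg
  -- A scale at which all generators map intervals onto intervals.
  choose δ hδ himg using fun s : S => exists_image_uIcc_eq (s : K ≃ₜ K) (hmono s).1 (hmono s).2
  obtain ⟨s₀, hs₀⟩ := Finite.exists_min δ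
  have hsmall : ∀ᶠ n : ℕ in Filter.atTop, 1 / ((n : ℝ) + 1) < δ s₀ :=
    (tendsto_one_div_add_atTop_nhds_zero_nat (𝕜 := ℝ)).eventually_lt_const (hδ s₀)
  obtain ⟨n, hn, hnδ⟩ := ((hlim.eventually_lt_const hLneg).and hsmall).exists
  refine exists_measure_isContracted_pos_of_exponent_neg P hμ hdist hC0 hC
    (ε := 1 / ((n : ℝ) + 1)) (by positivity)
    (fun s x y h => himg s x y (h.trans (hnδ.trans_le (hs₀ s)))) hθ ?_
  simp only [← hmR] at hn
  exact hn

end PositiveContraction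

/-! ### The probability of contraction -/

section ContractionProbability

variable {K : Set ℝ} {S : Set (K ≃ₜ K)}

lemma isContracted_consSeq [CompactSpace K] (l : ℝ) (s : S) (ω : ℕ → S) (x : K) :
    IsContracted l (consSeq s ω) x ↔ IsContracted l ω ((s : K ≃ₜ K) x) := by
  have hexp : ∀ n : ℕ, Real.exp (-((n + 1 : ℕ) * l)) = Real.exp (-(n * l)) * Real.exp (-l) := by
    intro n
    rw [← Real.exp_add]
    congr 1
    push_cast
    ring
  constructor
  · rintro ⟨B, hB, C, hC⟩
    refine ⟨(s : K ≃ₜ K) '' B, (s : K ≃ₜ K).isOpenMap.image_mem_nhds hB, C * Real.exp (-l),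
      fun n => ?_⟩
    have h := hC (n + 1)
    rw [randomComp_consSeq, Set.image_comp, hexp] at h
    exact h.trans_eq (by ring)
  · rintro ⟨B, hB, C, hC⟩
    refine ⟨(s : K ≃ₜ K) ⁻¹' B, (s : K ≃ₜ K).continuous.continuousAt hB,
      max (C * Real.exp l) (Metric.diam ((s : K ≃ₜ K) ⁻¹' B)), fun n => ?_⟩
    cases n with
    | zero => simp [randomComp]
    | succ n =>
      rw [randomComp_consSeq, Set.image_comp, Set.image_preimage_eq _ (s : K ≃ₜ K).surjective,
        hexp]
      calc _ ≤ C * Real.exp (-(n * l)) := hC n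
        _ = C * Real.exp l * (Real.exp (-(n * l)) * Real.exp (-l)) := by
            rw [Real.exp_neg l]
            field_simp
        _ ≤ _ := by gcongr; exact le_max_left _ _

lemma IsContracted.mono {l l' : ℝ} (h : l' ≤ l) {ω : ℕ → S} {x : K} (hx : IsContracted l ω x) :
    IsContracted l' ω x := by
  obtain ⟨B, hB, C, hC⟩ := hx
  have hC0 : 0 ≤ C := by simpa using Metric.diam_nonneg.trans (hC 0)
  exact ⟨B, hB, C, fun n => (hC n).trans (by gcongr)⟩

/-- Giving up half of the rate, a contracted neighborhood can be shrunk so as to remove the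
multiplicative constant. -/
lemma IsContracted.exists_diam_lt [CompactSpace K] {l : ℝ} (hl : 0 < l) {ω : ℕ → S} {x : K}
    (hx : IsContracted (2 * l) ω x) :
    ∃ B ∈ 𝓝 x, ∀ n : ℕ, Metric.diam (randomComp ω n '' B) < Real.exp (-(n * l)) := by
  obtain ⟨B₀, hB₀, C, hC⟩ := hx
  have hlim : Filter.Tendsto (fun n : ℕ => C * Real.exp (-(n * l))) Filter.atTop (𝓝 0) := by
    have h1 : Filter.Tendsto (fun n : ℕ => (n : ℝ) * l) Filter.atTop Filter.atTop :=
      tendsto_natCast_atTop_atTop.atTop_mul_const hl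
    simpa using (Real.tendsto_exp_neg_atTop_nhds_zero.comp h1).const_mul C
  obtain ⟨N, hN⟩ := Filter.eventually_atTop.1 (hlim.eventually_lt_const one_pos)
  -- The first `N` images are made small by continuity.
  set B : Set K := B₀ ∩ ⋂ k ∈ Finset.range N,
    randomComp ω k ⁻¹' Metric.ball (randomComp ω k x) (Real.exp (-(k * l)) / 3) with hB
  refine ⟨B, Filter.inter_mem hB₀ ((Filter.biInter_finset_mem _).2 fun k _ =>
    (continuous_randomComp ω k).continuousAt (Metric.ball_mem_nhds _ (by positivity))),
    fun n => ?_⟩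
  have hpos := Real.exp_pos (-(n * l))
  rcases lt_or_ge n N with h | h
  · have hsub : randomComp ω n '' B ⊆
        Metric.ball (randomComp ω n x) (Real.exp (-(n * l)) / 3) := by
      rintro _ ⟨y, hy, rfl⟩
      exact Set.mem_iInter₂.1 hy.2 n (Finset.mem_range.2 h)
    refine (Metric.diam_mono hsub Metric.isBounded_ball).trans_lt ?_
    refine (Metric.diam_ball (by positivity)).trans_lt ?_
    linarith
  · have h1 : Metric.diam (randomComp ω n '' B) ≤ Metric.diam (randomComp ω n '' B₀) :=
      Metric.diam_mono (Set.image_mono Set.inter_subset_left) (Metric.isBounded_of_compactSpace)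
    have h2 : C * Real.exp (-(n * (2 * l))) =
        C * Real.exp (-(n * l)) * Real.exp (-(n * l)) := by
      rw [mul_assoc, ← Real.exp_add]
      congr 2
      ring
    have h3 := (h1.trans (hC n)).trans_eq h2
    have h4 := hN n h
    nlinarith

/-- The trajectories `ω` that contract the set `U` at rate `l` with constant `C`. -/
def contractionEvent (S : Set (K ≃ₜ K)) (l : ℝ) (U : Set K) (C : ℕ) : Set (ℕ → S) :=
  {ω | ∀ n : ℕ, Metric.diam (randomComp ω n '' U) ≤ C * Real.exp (-(n * l))}

lemma isContracted_iff_exists_basis [CompactSpace K] {l : ℝ} {ω : ℕ → S} {x : K} :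
    IsContracted l ω x ↔ ∃ U ∈ TopologicalSpace.countableBasis K, ∃ C : ℕ,
      x ∈ U ∧ ω ∈ contractionEvent S l U C := by
  constructor
  · rintro ⟨B, hB, C, hC⟩
    obtain ⟨U, hU, hxU, hUB⟩ :=
      (TopologicalSpace.isBasis_countableBasis K).mem_nhds_iff.1 hB
    obtain ⟨C', hC'⟩ := exists_nat_ge C
    refine ⟨U, hU, C', hxU, fun n => ?_⟩
    calc Metric.diam (randomComp ω n '' U) ≤ Metric.diam (randomComp ω n '' B) :=
          Metric.diam_mono (Set.image_mono hUB) (Metric.isBounded_of_compactSpace)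
      _ ≤ C * Real.exp (-(n * l)) := hC n
      _ ≤ _ := by gcongr
  · rintro ⟨U, hU, C, hxU, hω⟩
    exact ⟨U, (TopologicalSpace.isOpen_of_mem_countableBasis hU).mem_nhds hxU, C, hω⟩

lemma randomComp_congr {ω ω' : ℕ → S} {n : ℕ} (h : ∀ i < n, ω i = ω' i) :
    randomComp ω n = randomComp ω' n := by
  induction n with
  | zero => rfl
  | succ n ih =>
    change (ω n : K ≃ₜ K) ∘ randomComp ω n = (ω' n : K ≃ₜ K) ∘ randomComp ω' n
    rw [ih fun i hi => h i (hi.trans n.lt_succ_self), h n n.lt_succ_self]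

/-- The probability that a neighborhood of `x` is contracted at rate `l`. -/
noncomputable def contractionProb [MeasurableSpace S] (P : Measure S) (l : ℝ) (x : K) : ENNReal :=
  Measure.infinitePi (fun _ : ℕ => P) {ω | IsContracted l ω x}

/-- The contraction probability is locally bounded below where it does not vanish. -/
lemma exists_contractionProb_ge [CompactSpace K] [MeasurableSpace S]
    (P : Measure S) {l : ℝ} {x : K} (hx : contractionProb P l x ≠ 0) :
    ∃ c > 0, ∃ U : Set K, IsOpen U ∧ x ∈ U ∧ ∀ y ∈ U, c ≤ contractionProb P l y := by
  set Q := Measure.infinitePi (fun _ : ℕ => P) with hQ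
  by_contra! hcon
  refine hx ?_
  have hsub : {ω : ℕ → S | IsContracted l ω x} ⊆
      ⋃ U ∈ {U ∈ TopologicalSpace.countableBasis K | x ∈ U}, ⋃ C : ℕ,
        contractionEvent S l U C := by
    intro ω hω
    obtain ⟨U, hU, C, hxU, hC⟩ := isContracted_iff_exists_basis.1 hω
    exact Set.mem_iUnion₂.2 ⟨U, ⟨hU, hxU⟩, Set.mem_iUnion.2 ⟨C, hC⟩⟩
  refine measure_mono_null hsub ((measure_biUnion_null_iff
    ((TopologicalSpace.countable_countableBasis K).mono fun U hU => hU.1)).2 fun U hU =>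
    measure_iUnion_null fun C => ?_)
  by_contra h0
  obtain ⟨y, hyU, hy⟩ := hcon _ (pos_iff_ne_zero.2 h0) U
    (TopologicalSpace.isOpen_of_mem_countableBasis hU.1) hU.2
  refine hy.not_ge (measure_mono fun ω hω => ?_)
  exact isContracted_iff_exists_basis.2 ⟨U, hU.1, C, hyU, hω⟩

lemma isClosed_contractionProb_eq_zero [CompactSpace K] [MeasurableSpace S]
    (P : Measure S) (l : ℝ) :
    IsClosed {x : K | contractionProb P l x = 0} := by
  refine ⟨isOpen_iff_forall_mem_open.2 fun x hx => ?_⟩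
  obtain ⟨c, hc, U, hU, hxU, hle⟩ := exists_contractionProb_ge P hx
  exact ⟨U, fun y hy => (hc.trans_le (hle y hy)).ne', hU, hxU⟩

variable [Fintype S] [MeasurableSpace S] [DiscreteMeasurableSpace S]

lemma measurableSet_contractionEvent (l : ℝ) (U : Set K) (C : ℕ) :
    MeasurableSet (contractionEvent S l U C) := by
  have : contractionEvent S l U C = ⋂ n : ℕ,
      {ω | Metric.diam (randomComp ω n '' U) ≤ C * Real.exp (-(n * l))} := by
    ext ω
    simp [contractionEvent]
  rw [this]
  refine MeasurableSet.iInter fun n => ?_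
  -- The `n`-th condition depends on the first `n` coordinates only.
  set A : Set (ℕ → S) := {ω | Metric.diam (randomComp ω n '' U) ≤ C * Real.exp (-(n * l))}
  let π : (ℕ → S) → (Fin n → S) := fun ω i => ω i
  have hπ : Measurable π := measurable_pi_lambda _ fun i => measurable_pi_apply _
  have hA : A = π ⁻¹' (π '' A) := by
    refine subset_antisymm (Set.subset_preimage_image _ _) ?_
    rintro ω ⟨ω', hω', h⟩
    have hcongr : randomComp ω' n = randomComp ω n :=
      randomComp_congr fun i hi => congrFun h ⟨i, hi⟩
    change Metric.diam (randomComp ω n '' U) ≤ _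
    rw [← hcongr]
    exact hω'
  rw [hA]
  exact hπ (Set.toFinite _).measurableSet

lemma measurableSet_isContracted_prod [CompactSpace K] (l : ℝ) :
    MeasurableSet {q : K × (ℕ → S) | IsContracted l q.2 q.1} := by
  have : {q : K × (ℕ → S) | IsContracted l q.2 q.1} =
      ⋃ U ∈ TopologicalSpace.countableBasis K, ⋃ C : ℕ, U ×ˢ contractionEvent S l U C := by
    ext q
    simp [isContracted_iff_exists_basis, and_left_comm]
  rw [this]
  refine MeasurableSet.biUnion (TopologicalSpace.countable_countableBasis K) fun U hU =>
    MeasurableSet.iUnion fun C => ?_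
  exact (TopologicalSpace.isOpen_of_mem_countableBasis hU).measurableSet.prod
    (measurableSet_contractionEvent l U C)

lemma measurableSet_isContracted [CompactSpace K] (l : ℝ) (x : K) :
    MeasurableSet {ω : ℕ → S | IsContracted l ω x} :=
  measurable_prodMk_left (x := x) (measurableSet_isContracted_prod (S := S) l)

variable (P : Measure S) [IsProbabilityMeasure P]

/-- The contraction probability is harmonic for the random walk. -/
lemma contractionProb_eq_sum [CompactSpace K] (l : ℝ) (x : K) :
    contractionProb P l x = ∑ s, P {s} * contractionProb P l ((s : K ≃ₜ K) x) := by
  rw [contractionProb, infinitePi_eq_sum_consSeq P (measurableSet_isContracted l x)]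
  refine Finset.sum_congr rfl fun s _ => ?_
  rw [contractionProb]
  congr 2
  ext ω
  exact isContracted_consSeq l s ω x

/-- If contraction at rate `l` has positive probability from every starting point, then it is
almost sure. -/
lemma ae_isContracted_of_contractionProb_ne_zero [CompactSpace K] {l : ℝ}
    (h : ∀ x : K, contractionProb P l x ≠ 0) (x : K) :
    ∀ᵐ ω ∂(Measure.infinitePi (fun _ : ℕ => P)), IsContracted l ω x := by
  obtain ⟨c, hc, hle⟩ : ∃ c > 0, ∀ y ∈ (Set.univ : Set K), c ≤ contractionProb P l y := by
    refine isCompact_univ.induction_on (p := fun A => ∃ c > 0, ∀ y ∈ A, c ≤ contractionProb P l y)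
      ⟨1, one_pos, by simp⟩ ?_ ?_ ?_
    · rintro A A' hAA ⟨c, hc, h⟩
      exact ⟨c, hc, fun y hy => h y (hAA hy)⟩
    · rintro A A' ⟨c, hc, h⟩ ⟨c', hc', h'⟩
      refine ⟨min c c', lt_min hc hc', fun y hy => hy.elim (fun hy => ?_) fun hy => ?_⟩
      · exact (min_le_left _ _).trans (h y hy)
      · exact (min_le_right _ _).trans (h' y hy)
    · intro y _
      obtain ⟨c, hc, U, hU, hyU, hle⟩ := exists_contractionProb_ge P (h y)
      exact ⟨U, mem_nhdsWithin_of_mem_nhds (hU.mem_nhds hyU), c, hc, hle⟩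
  refine infinitePi_eq_zero_of_le_of_tail P (fun (s : S) y => (s : K ≃ₜ K) y)
    (fun y => {ω | IsContracted l ω y}ᶜ) (fun y => (measurableSet_isContracted l y).compl)
    (fun y s ω => (isContracted_consSeq l s ω y).not) (r := 1 - c)
    (ENNReal.sub_lt_self ENNReal.one_ne_top one_ne_zero hc.ne') (fun y => ?_) x
  rw [prob_compl_eq_one_sub (measurableSet_isContracted l y)]
  exact tsub_le_tsub_left (hle y trivial) 1

end ContractionProbability

lemma isInvariantMeasure_of_map_eq {K : Set ℝ} {G : Subgroup (K ≃ₜ K)} {S : Set (K ≃ₜ K)}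
    (hSG : Subgroup.closure S = G) {μ : Measure K} (h : ∀ s ∈ S, μ.map s = μ) :
    IsInvariantMeasure G μ := by
  intro g hg A hA
  suffices hmap : μ.map g = μ by
    conv_rhs => rw [← hmap]
    rw [Measure.map_apply g.measurable hA]
  rw [← hSG] at hg
  induction hg using Subgroup.closure_induction with
  | mem s hs => exact h s hs
  | one => exact Measure.map_id
  | mul a b _ _ ha hb =>
    conv_rhs => rw [← ha, ← hb]
    rw [Measure.map_map a.measurable b.measurable]
    rfl
  | inv a _ ha =>
    conv_lhs => rw [← ha]
    rw [Measure.map_map a⁻¹.measurable a.measurable]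
    have : (a⁻¹ : K ≃ₜ K) ∘ a = id := funext fun x => a.symm_apply_apply x
    rw [this, Measure.map_id]

theorem mainTheorem9 (K : Set ℝ) (hK : IsCompact K)
    (G : Subgroup (K ≃ₜ K))
    (hG : ∀ g ∈ G, LocallyMonotonic (fun x : K => (g x : ℝ)))
    (S : Set (K ≃ₜ K)) (hS : S.Finite) (hSG : Subgroup.closure S = G)
    [MeasurableSpace S] [DiscreteMeasurableSpace S]
    (P : Measure S) [IsProbabilityMeasure P] (hP : ∀ s : S, 0 < P {s})
    (hinv : ¬ ∃ μ : Measure K, IsProbabilityMeasure μ ∧ IsInvariantMeasure G μ) :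
    ∃ l : ℝ, 0 < l ∧ ∀ x : K, ∀ᵐ ω ∂(Measure.infinitePi (fun _ : ℕ => P)),
      ∃ B ∈ 𝓝 x,
        (∀ n : ℕ, Metric.diam (randomComp ω n '' B) < Real.exp (-(n * l))) ∧
        ∀ n : ℕ, ∀ y ∈ B,
          dist (randomComp ω n x) (randomComp ω n y) ≤ Real.exp (-(l * n)) := by
  have hKc : CompactSpace K := isCompact_iff_compactSpace.1 hK
  have hfin : Fintype S := hS.fintype
  have hSsub : ∀ s : S, (s : K ≃ₜ K) ∈ G := fun s => hSG ▸ Subgroup.subset_closure s.2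
  have hmono : ∀ s : S, LocallyMonotonic (fun x => ((s : K ≃ₜ K) x : ℝ)) ∧
      LocallyMonotonic (fun x => ((s : K ≃ₜ K).symm x : ℝ)) := fun s =>
    ⟨hG _ (hSsub s), hG _ (G.inv_mem (hSsub s))⟩
  have hP0 : ∀ s, P {s} ≠ 0 := fun s => (hP s).ne'
  -- Some rate has positive contraction probability at every point.
  obtain ⟨l, hl, hlpos⟩ : ∃ l > 0, ∀ x : K, contractionProb P l x ≠ 0 := by
    by_contra! hcon
    set Z : ℕ → Set K := fun k => {x | contractionProb P (1 / ((k : ℝ) + 1)) x = 0} with hZ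
    have hZclosed : ∀ k, IsClosed (Z k) := fun k => isClosed_contractionProb_eq_zero P _
    have hZne : (⋂ k, Z k).Nonempty := by
      refine IsCompact.nonempty_iInter_of_sequence_nonempty_isCompact_isClosed Z (fun k => ?_)
        (fun k => hcon _ (by positivity)) (hZclosed 0).isCompact hZclosed
      intro x hx
      refine measure_mono_null ?_ hx
      intro ω hω
      exact IsContracted.mono (Nat.one_div_le_one_div (Nat.le_succ k)) hω
    have hZinv : ∀ s : S, ∀ x ∈ ⋂ k, Z k, (s : K ≃ₜ K) x ∈ ⋂ k, Z k := by
      intro s x hx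
      refine Set.mem_iInter.2 fun k => ?_
      have h0 : contractionProb P (1 / ((k : ℝ) + 1)) x = 0 := Set.mem_iInter.1 hx k
      rw [contractionProb_eq_sum, Finset.sum_eq_zero_iff] at h0
      exact (mul_eq_zero.1 (h0 s (Finset.mem_univ s))).resolve_left (hP0 s)
    obtain ⟨μ, hμp, hμ, hμZ⟩ := exists_stationary_measure P
      (f := fun s : S => ((s : K ≃ₜ K) : K → K)) (fun s => (s : K ≃ₜ K).continuous)
      (isClosed_iInter hZclosed) hZne hZinv
    have hninv : ¬ ∀ s : S, μ.map (s : K ≃ₜ K) = μ := fun h =>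
      hinv ⟨μ, hμp, isInvariantMeasure_of_map_eq hSG fun s hs => h ⟨s, hs⟩⟩
    obtain ⟨l, hl, hpos⟩ := exists_measure_isContracted_pos P hP0 hmono hμ hninv
    obtain ⟨k, hk⟩ := exists_nat_one_div_lt hl
    refine hpos ((Measure.measure_prod_null (measurableSet_isContracted_prod l)).2 ?_)
    have hae : ∀ᵐ x ∂μ, x ∈ ⋂ k, Z k := hμZ
    filter_upwards [hae] with x hx
    have h0 : contractionProb P (1 / ((k : ℝ) + 1)) x = 0 := Set.mem_iInter.1 hx k
    refine measure_mono_null ?_ h0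
    intro ω hω
    exact IsContracted.mono hk.le hω
  refine ⟨l / 2, half_pos hl, fun x => ?_⟩
  filter_upwards [ae_isContracted_of_contractionProb_ne_zero P hlpos x] with ω hω
  obtain ⟨B, hB, hdiam⟩ := IsContracted.exists_diam_lt (half_pos hl)
    (by rwa [mul_div_cancel₀ l two_ne_zero] : IsContracted (2 * (l / 2)) ω x)
  refine ⟨B, hB, hdiam, fun n y hy => ?_⟩
  rw [mul_comm (l / 2)]
  exact (Metric.dist_le_diam_of_mem Metric.isBounded_of_compactSpace
    (Set.mem_image_of_mem _ (mem_of_mem_nhds hB)) (Set.mem_image_of_mem _ hy)).trans (hdiam n).le
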